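/- For $\kappa,\mu\in\mathbb C$ let $W_{\kappa,\mu}(z)$ be the Whittaker $W$-function, that is, the solution of $$F''+\Big(-\tfrac14+\tfrac{\kappa}{z}+\tfrac{1/4-\mu^2}{z^2}\Big)F=0$$ on the Riemann surface of the logarithm with $W_{\kappa,\mu}(z)\sim e^{-z/2}z^{\kappa}$ as $|z|\to\infty$ in $|\arg z|\le\frac{3\pi}{2}-\delta$, for every $\delta>0$. For each $z$ with $|\arg z|<\frac{3\pi}2$ it is an entire function of $\mu$. Let $-z$ denote either $ze^{\pi i}$ or $ze^{-\pi i}$ (one fixed choice; the statement holds for both). Fix $\kappa,\mu_0\in\mathbb C$. 1. If $\mu_0\neq0$, then for every $m\ge0$ the $2m+2$ functions $$\partial_\mu^jW_{\kappa,\mu}(z)\big|_{\mu=\mu_0},\qquad \partial_\mu^jW_{-\kappa,\mu}(-z)\big|_{\mu=\mu_0}\qquad(0\le j\le m)$$ are linearly independent over $\mathbb C$, as functions on each ray $\arg z=\theta$ such that $|\theta|<\frac{3\pi}2$ and $|\arg(-z)|<\frac{3\pi}2$ on the ray; in particular on the positive real axis. 2. If $\mu_0=0$, then for every $m\ge0$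 the $2m+2$ functions $$\partial_\mu^{2j}W_{\kappa,\mu}(z)\big|_{\mu=0},\qquad \partial_\mu^{2j}W_{-\kappa,\mu}(-z)\big|_{\mu=0}\qquad(0\le j\le m)$$ are linearly independent over $\mathbb C$ on each such ray. All odd-order derivatives $\partial_\mu^{2j+1}W_{\kappa,\mu}(z)|_{\mu=0}$ and $\partial_\mu^{2j+1}W_{-\kappa,\mu}(z)|_{\mu=0}$, $j\ge0$, vanish identically in $|\arg z|<\frac{3\pi}2$. 3. For every $\mu_0$ (zero or not), every finite $\mathbb C$-linear combination $f(y)$ of the functions $\partial_\mu^jW_{\kappa,\mu}(y)|_{\mu=\mu_0}$, $j\ge0$, of $y>0$ decays exponentially: $f(y)=O(e^{-cy})$ as $y\to\infty$ for some $c>0$. Every finite $\mathbb C$-linear combination $f(y)$ of the functions $\partial_\mu^jW_{-\kappa,\mu}(-y)|_{\mu=\mu_0}$, $j\ge0$, of $y>0$ that is not identically zero grows exponentially: $e^{cy}=O(f(y))$ and $f(y)=O(e^{Cy})$ as $y\to\infty$ for some $c>0$ and $C\in\mathbb R$. -/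

import Mathlib

open Complex MeasureTheory Filter Asymptotics

noncomputable section

/-- The integral `Γ(a)⁻¹ ∫ e^{-t} t^{a-1} (1 + t / z)^{-c} dt` for `Re a > 0`, at the point
`z = e^ζ`, `|arg z| < 3π/2`, of the Riemann surface of the logarithm (so `arg z = Im ζ`).
The path is the ray `t = s e^{iφ}`, `s > 0`, with `φ = (arg z) / 3`: then `|φ| < π/2`, so that
`e^{-t}` decays, and `|φ - arg z| < π`, so that `1 + t / z` stays off the negative axis and its
principal power is the branch that equals `1` at `t = 0`. By Cauchy's theorem this is the
analytic continuation in `z` of the integral over the positive axis. -/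
def whittakerIntegral (a c ζ : ℂ) : ℂ :=
  (Complex.Gamma a)⁻¹ * exp (a * ((ζ.im / 3 : ℝ) * I)) *
    ∫ s : ℝ in Set.Ioi 0,
      (s : ℂ) ^ (a - 1) * exp (-(s * exp ((ζ.im / 3 : ℝ) * I))) *
        (1 + s * exp ((ζ.im / 3 : ℝ) * I - ζ)) ^ (-c)

/-- Continuation of `whittakerIntegral` in `a` to `Re a > -n` by integration by parts:
`V(a, c) = V(a + 1, c) + (c / z) V(a + 1, c + 1)`. -/
def whittakerAux : ℕ → ℂ → ℂ → ℂ → ℂ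
  | 0, a, c, ζ => whittakerIntegral a c ζ
  | n + 1, a, c, ζ =>
      whittakerAux n (a + 1) c ζ + c * exp (-ζ) * whittakerAux n (a + 1) (c + 1) ζ

/-- The Whittaker function `W_{κ,μ}(z)` at the point `z = e^ζ`, `|Im ζ| < 3π/2`, of the Riemann
surface of the logarithm, for all `κ, μ ∈ ℂ`:
`W_{κ,μ}(z) = e^{-z/2} z^κ Γ(½+μ-κ)⁻¹ ∫ e^{-t} t^{μ-κ-½} (1 + t / z)^{μ+κ-½} dt`,
continued analytically in the parameters. -/
def whittakerW (κ μ ζ : ℂ) : ℂ :=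
  exp (-(exp ζ / 2)) * exp (κ * ζ) *
    whittakerAux ⌊1 - (1 / 2 + μ - κ).re⌋₊ (1 / 2 + μ - κ) (1 / 2 - μ - κ) ζ

/-- `∂^j/∂μ^j W_{κ,μ}(z)` at `μ = μ₀`, `z = e^ζ`. -/
def whittakerDeriv (j : ℕ) (κ μ₀ ζ : ℂ) : ℂ :=
  iteratedDeriv j (fun μ : ℂ => whittakerW κ μ ζ) μ₀

/-- The logarithm `log r + iθ` of the point of modulus `r` and argument `θ`. -/
def polarLog (r θ : ℝ) : ℂ := (Real.log r : ℂ) + θ * I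

/-- `f(y)` decays exponentially as `y → ∞`. -/
def DecaysExponentially (f : ℝ → ℂ) : Prop :=
  ∃ c : ℝ, 0 < c ∧ f =O[atTop] fun y : ℝ => Real.exp (-(c * y))

/-- `f(y)` grows exponentially as `y → ∞` (at least and at most exponentially). -/
def GrowsExponentially (f : ℝ → ℂ) : Prop :=
  ∃ c C : ℝ, 0 < c ∧ (fun y : ℝ => Real.exp (c * y)) =O[atTop] f ∧
    f =O[atTop] fun y : ℝ => Real.exp (C * y)

end

/-! Write `W_{κ,μ}(z) = e^{-z/2} z^κ V`. On each ray `V` has an expansion `∑ P_k(μ) z^{-k}`, uniform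
for `μ` in a disc (`exists_norm_whittakerV_sub_le`), so Cauchy's estimates allow termwise
differentiation in `μ`. A combination `∑ c_j ∂_μ^j W` at `μ₀` is therefore `e^{-z/2} z^κ` times a
series with coefficients `Λ(P_k)`, where `Λ(P) = ∑ c_j P^{(j)}(μ₀)`.

The recurrence `-(k+1) P_{k+1} = ((1/2-κ+k)² - μ²) P_k` shows that if `Λ` kills every `P_k`, it
kills every power of `X² - μ₀²`. For `μ₀ ≠ 0` this polynomial has a simple zero at `μ₀`, which
forces all `c_j = 0`; for `μ₀ = 0` only the even orders are detected
(`eq_zero_of_derivFunctional_whittakerPoly_eq_zero`). The odd orders vanish at `0` because `W` is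
even in `μ`, by the symmetry of `V` in its two parameters (`whittakerV_symm`).

Hence every nontrivial combination is asymptotic to a nonzero multiple of some `e^{-z/2} z^{κ-k}`
(`whittakerVComb_dichotomy`), which gives decay and growth. A relation between the two families
would give some `e^z z^β` a finite nonzero limit along a ray, which
`not_tendsto_exp_mul_exp_add_log` excludes even where `|e^z| = 1`. -/

open scoped Topology

/-! ### Holomorphy of parameter integrals -/

/-- An integral whose integrand is holomorphic in a parameter and locally dominated by an
integrable function is holomorphic in the parameter. -/
theorem differentiableAt_integral_of_dominated {α : Type*} [MeasurableSpace α] {μ : Measure α}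
    {F : ℂ → α → ℂ} {x₀ : ℂ} {R : ℝ} (hR : 0 < R) {bound : α → ℝ}
    (hmeas : ∀ x ∈ Metric.ball x₀ R, AEStronglyMeasurable (F x) μ)
    (hbound : ∀ᵐ t ∂μ, ∀ x ∈ Metric.ball x₀ R, ‖F x t‖ ≤ bound t)
    (hint : Integrable bound μ)
    (hdiff : ∀ᵐ t ∂μ, ∀ x ∈ Metric.ball x₀ R, DifferentiableAt ℂ (fun x => F x t) x) :
    DifferentiableAt ℂ (fun x => ∫ t, F x t ∂μ) x₀ := by
  have h0 : x₀ ∈ Metric.ball x₀ R := Metric.mem_ball_self hR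
  have hderiv_meas : AEStronglyMeasurable (fun t => deriv (fun x => F x t) x₀) μ := by
    -- The derivative is measurable in `t` as the limit of difference quotients along this null
    -- sequence.
    let e : ℕ → ℂ := fun n => ((R / 2 / (n + 1) : ℝ) : ℂ)
    have he0 : ∀ n : ℕ, 0 < R / 2 / ((n : ℝ) + 1) := fun n => by positivity
    have heR : ∀ n, x₀ + e n ∈ Metric.ball x₀ R := fun n => by
      simp only [e, Metric.mem_ball, dist_self_add_left, norm_real, Real.norm_eq_abs,
        abs_of_pos (he0 n)]
      calc R / 2 / ((n : ℝ) + 1) ≤ R / 2 := div_le_self (by positivity) (by simp)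
        _ < R := by linarith
    have het : Tendsto e atTop (𝓝[≠] 0) := by
      refine tendsto_nhdsWithin_iff.2 ⟨?_, Eventually.of_forall fun n => ?_⟩
      · have : Tendsto (fun n : ℕ => R / 2 / ((n : ℝ) + 1)) atTop (𝓝 0) := by
          simpa [div_eq_mul_inv] using
            (tendsto_one_div_add_atTop_nhds_zero_nat (𝕜 := ℝ)).const_mul (R / 2)
        have h := (continuous_ofReal.tendsto (0 : ℝ)).comp this
        simpa [e, Function.comp_def] using h
      · simp only [Set.mem_compl_iff, Set.mem_singleton_iff, e, ofReal_eq_zero]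
        exact (he0 n).ne'
    refine aestronglyMeasurable_of_tendsto_ae (u := atTop)
      (f := fun n t => (e n)⁻¹ • (F (x₀ + e n) t - F x₀ t)) (fun n => ?_) ?_
    · exact ((hmeas _ (heR n)).sub (hmeas _ h0)).const_smul (e n)⁻¹
    · filter_upwards [hdiff] with t ht
      exact (hasDerivAt_iff_tendsto_slope_zero.1 (ht x₀ h0).hasDerivAt).comp het
  refine (hasDerivAt_integral_of_dominated_loc_of_deriv_le
    (F' := fun x t => deriv (fun x => F x t) x) (bound := fun t => bound t / (R / 2 / 2))
    (Metric.ball_mem_nhds x₀ (by positivity : 0 < R / 2)) ?_ ?_ hderiv_meas ?_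
    (hint.div_const _) ?_).2.differentiableAt
  · filter_upwards [Metric.ball_mem_nhds x₀ hR] with x hx using hmeas x hx
  · refine hint.mono' (hmeas _ h0) ?_
    filter_upwards [hbound] with t ht using ht _ h0
  · filter_upwards [hbound, hdiff] with t ht hd x hx
    have hsub : Metric.closedBall x (R / 2 / 2) ⊆ Metric.ball x₀ R := fun y hy => by
      rw [Metric.mem_closedBall] at hy
      rw [Metric.mem_ball] at hx ⊢
      linarith [dist_triangle y x x₀]
    -- Cauchy's estimate on a circle of radius `R/4`, which stays inside the original ball.
    refine norm_deriv_le_of_forall_mem_sphere_norm_le (by positivity) ?_ fun z hz =>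
      ht z (hsub (Metric.sphere_subset_closedBall hz))
    refine DifferentiableOn.diffContOnCl fun z hz => ?_
    exact (hd z (hsub (Metric.closure_ball_subset_closedBall hz))).differentiableWithinAt
  · filter_upwards [hdiff] with t ht x hx
    exact (ht x (Metric.ball_subset_ball (by linarith) hx)).hasDerivAt

/-! ### Bounds for powers of `1 + y w` -/

theorem one_add_ofReal_mul_mem_slitPlane {w : ℂ} (hw : w ∈ slitPlane) {y : ℝ} (hy : 0 ≤ y) :
    1 + y * w ∈ slitPlane := by
  rw [mem_slitPlane_iff] at hw ⊢
  simp only [add_re, one_re, mul_re, ofReal_re, ofReal_im, zero_mul, sub_zero, add_im, one_im,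
    mul_im, add_zero, zero_add]
  rcases hy.eq_or_lt with rfl | hy
  · simp
  · rcases hw with hw | hw
    · left; positivity
    · right; simp [hy.ne', hw]

/-- If `Re w > 0` the real part is at least `1`. Otherwise `Im w ≠ 0`, and `(1 + y w) w̄` has
imaginary part `-Im w`, independent of `y`. -/
theorem exists_le_norm_one_add_ofReal_mul {w : ℂ} (hw : w ∈ slitPlane) :
    ∃ δ : ℝ, 0 < δ ∧ ∀ y : ℝ, 0 ≤ y → δ ≤ ‖1 + y * w‖ := by
  rw [mem_slitPlane_iff] at hw
  by_cases hre : 0 < w.re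
  · refine ⟨1, one_pos, fun y hy => ?_⟩
    refine le_trans ?_ (re_le_norm _)
    simp; positivity
  · have him : w.im ≠ 0 := hw.resolve_left hre
    have hw0 : w ≠ 0 := fun h => him (by simp [h])
    refine ⟨|w.im| / ‖w‖, by positivity, fun y hy => ?_⟩
    rw [div_le_iff₀ (by positivity)]
    have h := abs_im_le_norm ((1 + y * w) * (starRingEnd ℂ) w)
    rw [norm_mul, norm_conj] at h
    have he : ((1 + y * w) * (starRingEnd ℂ) w).im = -w.im := by
      simp; ring
    rwa [he, abs_neg] at h

/-- Powers of `1 + y w`, `y ≥ 0`, grow at most polynomially, locally uniformly in the exponent. -/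
theorem exists_norm_one_add_cpow_le {w : ℂ} (hw : w ∈ slitPlane) (B : ℝ) :
    ∃ (C : ℝ) (M : ℕ), 0 ≤ C ∧ ∀ c : ℂ, ‖c‖ ≤ B → ∀ y : ℝ, 0 ≤ y →
      ‖(1 + y * w) ^ (-c)‖ ≤ C * (1 + y) ^ M := by
  obtain ⟨δ, hδ, hle⟩ := exists_le_norm_one_add_ofReal_mul hw
  obtain ⟨M, hM⟩ := exists_nat_ge B
  -- `K (1 + y)` bounds both `ρ` and `ρ⁻¹`, so the sign of the real exponent is immaterial.
  set K : ℝ := max (1 + ‖w‖) δ⁻¹ with hK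
  have hK1 : 1 ≤ K := le_trans (by simp) (le_max_left _ _)
  refine ⟨K ^ M * Real.exp (Real.pi * M), M, by positivity, fun c hc y hy => ?_⟩
  have hcM : ‖c‖ ≤ M := hc.trans hM
  set ρ := ‖1 + y * w‖ with hρ
  have hρ0 : 0 < ρ := hδ.trans_le (hle y hy)
  have hb1 : 1 ≤ K * (1 + y) := one_le_mul_of_one_le_of_one_le hK1 (by linarith)
  have hρ1 : ρ ≤ K * (1 + y) := by
    calc ρ ≤ 1 + y * ‖w‖ := by
          refine (norm_add_le _ _).trans ?_
          simp [abs_of_nonneg hy]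
      _ ≤ (1 + ‖w‖) * (1 + y) := by nlinarith [norm_nonneg w]
      _ ≤ _ := by gcongr; exact le_max_left _ _
  have hρ2 : ρ⁻¹ ≤ K * (1 + y) := by
    calc ρ⁻¹ ≤ δ⁻¹ := inv_anti₀ hδ (hle y hy)
      _ ≤ K := le_max_right _ _
      _ ≤ _ := le_mul_of_one_le_right (by positivity) (by linarith)
  have hpow : ρ ^ (-c).re ≤ (K * (1 + y)) ^ M := by
    have hre : |(-c).re| ≤ M := (abs_re_le_norm _).trans (by simpa using hcM)
    rw [← Real.rpow_natCast]
    rcases le_total 0 (-c).re with h | h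
    · exact (Real.rpow_le_rpow hρ0.le hρ1 h).trans
        (Real.rpow_le_rpow_of_exponent_le hb1 ((le_abs_self _).trans hre))
    · have : ρ ^ (-c).re = ρ⁻¹ ^ (-(-c).re) := by
        rw [Real.inv_rpow hρ0.le, Real.rpow_neg hρ0.le, inv_inv]
      rw [this]
      exact (Real.rpow_le_rpow (by positivity) hρ2 (by linarith)).trans
        (Real.rpow_le_rpow_of_exponent_le hb1 ((neg_le_abs _).trans hre))
  refine (norm_cpow_le _ _).trans ?_
  rw [div_eq_mul_inv, ← Real.exp_neg]
  have hexp : Real.exp (-(arg (1 + y * w) * (-c).im)) ≤ Real.exp (Real.pi * M) := by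
    refine Real.exp_le_exp.2 ((neg_le_abs _).trans ?_)
    rw [abs_mul]
    exact mul_le_mul (abs_arg_le_pi _) ((abs_im_le_norm _).trans (by simpa using hcM))
      (abs_nonneg _) Real.pi_pos.le
  calc _ ≤ (K * (1 + y)) ^ M * Real.exp (Real.pi * M) :=
        mul_le_mul hpow hexp (Real.exp_pos _).le (by positivity)
    _ = _ := by rw [mul_pow]; ring

/-! ### Euler integrals along complex rays -/

theorem integrableOn_rpow_mul_exp_mul_one_add_pow {k : ℝ} (hk : 0 < k) (M : ℕ) {α : ℝ}
    (hα : 0 < α) :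
    IntegrableOn (fun s : ℝ => s ^ (α - 1) * Real.exp (-(k * s)) * (1 + s) ^ M) (Set.Ioi 0) := by
  induction M generalizing α with
  | zero =>
    simpa using integrableOn_rpow_mul_exp_neg_mul_rpow (s := α - 1) (p := 1) (b := k)
      (by linarith) one_pos hk
  | succ M ih =>
    refine ((ih hα).add (ih (α := α + 1) (by linarith))).congr_fun (fun s hs => ?_)
      measurableSet_Ioi
    have hs : 0 < s := hs
    have : s ^ (α + 1 - 1) = s ^ (α - 1) * s := by
      rw [← Real.rpow_add_one hs.ne']; ring_nf
    simp only [Pi.add_apply, this]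
    ring

theorem norm_ofReal_cpow_mul_exp {s : ℝ} (hs : 0 < s) (a u : ℂ) :
    ‖(s : ℂ) ^ (a - 1) * exp (-(s * u))‖ = s ^ (a.re - 1) * Real.exp (-(u.re * s)) := by
  rw [norm_mul, norm_cpow_eq_rpow_re_of_pos hs, norm_exp]
  simp [mul_comm]

theorem integrableOn_cpow_mul_exp {a u : ℂ} (ha : 0 < a.re) (hu : 0 < u.re) :
    IntegrableOn (fun s : ℝ => (s : ℂ) ^ (a - 1) * exp (-(s * u))) (Set.Ioi 0) := by
  have h := integrableOn_rpow_mul_exp_mul_one_add_pow hu 0 ha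
  refine h.mono' ?_ ?_
  · refine ContinuousOn.aestronglyMeasurable (fun s hs => ?_) measurableSet_Ioi
    have hs : 0 < s := hs
    refine ContinuousAt.continuousWithinAt (ContinuousAt.mul ?_ (by fun_prop))
    exact (continuousAt_ofReal_cpow_const _ _ (Or.inr hs.ne'))
  · filter_upwards [ae_restrict_mem measurableSet_Ioi] with s hs
    rw [norm_ofReal_cpow_mul_exp hs]
    simp

/-- Euler's integral along a ray in the right half plane. -/
theorem integral_cpow_mul_exp_neg_mul_complex {a : ℂ} (ha : 0 < a.re) {u : ℂ} (hu : 0 < u.re) :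
    ∫ s : ℝ in Set.Ioi 0, (s : ℂ) ^ (a - 1) * exp (-(s * u)) = Gamma a * u ^ (-a) := by
  set U : Set ℂ := {u : ℂ | 0 < u.re} with hU
  have hUo : IsOpen U := isOpen_lt continuous_const continuous_re
  have hUc : IsPreconnected U := (convex_halfSpace_re_gt 0).isPreconnected
  have hd1 : DifferentiableOn ℂ
      (fun u : ℂ => ∫ s : ℝ in Set.Ioi 0, (s : ℂ) ^ (a - 1) * exp (-(s * u))) U := by
    intro v hv
    have hv : 0 < v.re := hv
    refine (differentiableAt_integral_of_dominated (R := v.re / 2) (by positivity)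
      (bound := fun s => s ^ (a.re - 1) * Real.exp (-(v.re / 2 * s)) * (1 + s) ^ 0)
      (fun x hx => ?_) ?_ (integrableOn_rpow_mul_exp_mul_one_add_pow (by positivity) 0 ha)
      ?_).differentiableWithinAt
    · refine (integrableOn_cpow_mul_exp ha ?_).aestronglyMeasurable
      have := (abs_re_le_norm (x - v)).trans_lt (by simpa [dist_eq] using hx)
      rw [sub_re, abs_lt] at this
      linarith
    · filter_upwards [ae_restrict_mem measurableSet_Ioi] with s hs x hx
      have hs : 0 < s := hs
      have := (abs_re_le_norm (x - v)).trans_lt (by simpa [dist_eq] using hx)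
      rw [sub_re, abs_lt] at this
      rw [norm_ofReal_cpow_mul_exp hs, pow_zero, mul_one]
      gcongr
      linarith
    · exact Eventually.of_forall fun s x _ => by fun_prop
  have hd2 : DifferentiableOn ℂ (fun u : ℂ => Gamma a * u ^ (-a)) U := fun v hv =>
    ((differentiableAt_id.cpow_const (Or.inl hv)).const_mul _).differentiableWithinAt
  -- Identity theorem: the real case gives equality at the points `1 + 1/(n+1)`, which accumulate at
  -- `1`.
  refine (hd1.analyticOnNhd hUo).eqOn_of_preconnected_of_frequently_eq (hd2.analyticOnNhd hUo)
    hUc (z₀ := 1) (by simp [hU]) ?_ hu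
  have ht : Tendsto (fun n : ℕ => ((1 + 1 / ((n : ℝ) + 1) : ℝ) : ℂ)) atTop (𝓝[≠] 1) := by
    refine tendsto_nhdsWithin_iff.2 ⟨?_, Eventually.of_forall fun n => ?_⟩
    · have := (tendsto_one_div_add_atTop_nhds_zero_nat (𝕜 := ℝ)).const_add 1
      rw [add_zero] at this
      simpa [Function.comp_def] using (continuous_ofReal.tendsto (1 : ℝ)).comp this
    · simp only [Set.mem_compl_iff, Set.mem_singleton_iff]
      have : (0 : ℝ) < 1 / ((n : ℝ) + 1) := by positivity
      rw [← ofReal_one, ofReal_inj]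
      linarith
  refine ht.frequently (Frequently.of_forall fun n => ?_)
  have hr : (0 : ℝ) < 1 + 1 / ((n : ℝ) + 1) := by positivity
  have h := integral_cpow_mul_exp_neg_mul_Ioi ha hr
  simp only [mul_comm (((1 + 1 / ((n : ℝ) + 1) : ℝ) : ℂ))] at h
  rw [h, one_div, inv_cpow, cpow_neg, mul_comm]
  rw [arg_ofReal_of_nonneg hr.le]
  exact Real.pi_pos.ne

/-! ### The Whittaker kernel: recurrences and symmetry -/

/-- The integrand `s^{a-1} e^{-su} (1 + sw)^{-c}` of the Whittaker integral. -/
noncomputable def whittakerKernel (u w a c : ℂ) (s : ℝ) : ℂ :=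
  (s : ℂ) ^ (a - 1) * exp (-(s * u)) * (1 + s * w) ^ (-c)

theorem continuousOn_whittakerKernel (u a c : ℂ) {w : ℂ} (hw : w ∈ slitPlane) :
    ContinuousOn (whittakerKernel u w a c) (Set.Ioi 0) := by
  intro s hs
  have hs : 0 < s := hs
  refine ContinuousAt.continuousWithinAt ?_
  refine ((continuousAt_ofReal_cpow_const _ _ (Or.inr hs.ne')).mul (by fun_prop)).mul ?_
  exact ContinuousAt.cpow (by fun_prop) continuousAt_const
    (one_add_ofReal_mul_mem_slitPlane hw hs.le)

theorem norm_whittakerKernel {s : ℝ} (hs : 0 < s) (u w a c : ℂ) :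
    ‖whittakerKernel u w a c s‖ =
      s ^ (a.re - 1) * Real.exp (-(u.re * s)) * ‖(1 + s * w) ^ (-c)‖ := by
  rw [whittakerKernel, norm_mul, norm_ofReal_cpow_mul_exp hs]

theorem integrableOn_whittakerKernel {u w a : ℂ} (hu : 0 < u.re) (hw : w ∈ slitPlane)
    (ha : 0 < a.re) (c : ℂ) : IntegrableOn (whittakerKernel u w a c) (Set.Ioi 0) := by
  obtain ⟨C, M, hC, h⟩ := exists_norm_one_add_cpow_le hw ‖c‖
  refine ((integrableOn_rpow_mul_exp_mul_one_add_pow hu M ha).const_mul C).mono'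
    ((continuousOn_whittakerKernel u a c hw).aestronglyMeasurable measurableSet_Ioi) ?_
  filter_upwards [ae_restrict_mem measurableSet_Ioi] with s hs
  have hs : 0 < s := hs
  rw [norm_whittakerKernel hs]
  calc _ ≤ s ^ (a.re - 1) * Real.exp (-(u.re * s)) * (C * (1 + s) ^ M) := by
        gcongr; exact h c le_rfl s hs.le
    _ = _ := by ring

/-- Integration by parts in the Whittaker integral. -/
theorem integral_whittakerKernel_by_parts {u w a : ℂ} (hu : 0 < u.re) (hw : w ∈ slitPlane)
    (ha : 0 < a.re) (c : ℂ) :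
    a * ∫ s in Set.Ioi 0, whittakerKernel u w a c s =
      u * (∫ s in Set.Ioi 0, whittakerKernel u w (a + 1) c s) +
        c * w * ∫ s in Set.Ioi 0, whittakerKernel u w (a + 1) (c + 1) s := by
  have ha0 : a ≠ 0 := fun h => by simp [h] at ha
  have ha1 : 0 < (a + 1).re := by simp; linarith
  have i1 := (integrableOn_whittakerKernel hu hw ha c).const_mul a
  have i2 := (integrableOn_whittakerKernel hu hw ha1 c).const_mul u
  have i3 := (integrableOn_whittakerKernel hu hw ha1 (c + 1)).const_mul (c * w)
  have i4 : IntegrableOn (fun s => u * whittakerKernel u w (a + 1) c s +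
      c * w * whittakerKernel u w (a + 1) (c + 1) s) (Set.Ioi 0) := i2.add i3
  have hcont : ContinuousWithinAt (whittakerKernel u w (a + 1) c) (Set.Ici 0) 0 := by
    refine ContinuousAt.continuousWithinAt ?_
    refine (ContinuousAt.mul ?_ (by fun_prop)).mul ?_
    · exact continuousAt_ofReal_cpow_const _ _ (Or.inl (by simpa using ha))
    · exact ContinuousAt.cpow (by fun_prop) continuousAt_const (by simp)
  have hderiv : ∀ s ∈ Set.Ioi (0 : ℝ), HasDerivAt (whittakerKernel u w (a + 1) c)
      (a * whittakerKernel u w a c s - (u * whittakerKernel u w (a + 1) c s +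
        c * w * whittakerKernel u w (a + 1) (c + 1) s)) s := by
    intro s hs
    have hs : 0 < s := hs
    have hsl := one_add_ofReal_mul_mem_slitPlane hw hs.le
    have h1 : HasDerivAt (fun s : ℝ => (s : ℂ) ^ (a + 1 - 1)) (a * (s : ℂ) ^ (a - 1)) s := by
      simpa using hasDerivAt_ofReal_cpow_const hs.ne' ha0
    have h2 : HasDerivAt (fun s : ℝ => exp (-(s * u))) (exp (-(s * u)) * (-(1 * u))) s := by
      exact (((hasDerivAt_id (s : ℂ)).mul_const u).neg.cexp).comp_ofReal
    have h3 : HasDerivAt (fun s : ℝ => (1 + s * w) ^ (-c))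
        (-c * (1 + s * w) ^ (-c - 1) * (1 * w)) s := by
      exact ((((hasDerivAt_id (s : ℂ)).mul_const w).const_add 1).cpow_const hsl).comp_ofReal
    refine ((h1.mul h2).mul h3).congr_deriv ?_
    have e1 : -(c + 1) = -c - 1 := by ring
    simp only [whittakerKernel, e1, add_sub_cancel_right, Pi.mul_apply]
    ring
  have htend : Tendsto (whittakerKernel u w (a + 1) c) atTop (𝓝 0) := by
    obtain ⟨C, M, hC, h⟩ := exists_norm_one_add_cpow_le hw ‖c‖
    have ht := ((tendsto_rpow_mul_exp_neg_mul_atTop_nhds_zero (a.re + M) u.re hu).const_mul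
      (C * 2 ^ M))
    rw [mul_zero] at ht
    refine squeeze_zero_norm' ?_ ht
    filter_upwards [eventually_ge_atTop 1] with s hs
    have hs0 : 0 < s := by linarith
    rw [norm_whittakerKernel hs0, Real.rpow_add hs0, Real.rpow_natCast]
    have : (a + 1).re - 1 = a.re := by simp
    rw [this]
    calc _ ≤ s ^ a.re * Real.exp (-(u.re * s)) * (C * (2 * s) ^ M) := by
          gcongr
          refine (h c le_rfl s hs0.le).trans ?_
          gcongr
          linarith
      _ = _ := by rw [mul_pow, neg_mul]; ring
  have h := integral_Ioi_of_hasDerivAt_of_tendsto hcont hderiv (i1.sub i4) htend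
  have h0 : whittakerKernel u w (a + 1) c 0 = 0 := by simp [whittakerKernel, ha0]
  rw [h0, sub_zero, integral_sub i1 i4, integral_add i2 i3] at h
  simp only [integral_const_mul] at h
  exact sub_eq_zero.1 h

theorem whittakerKernel_eq_add {w : ℂ} (hw : w ∈ slitPlane) (u a c : ℂ) {s : ℝ} (hs : 0 < s) :
    whittakerKernel u w a c s =
      whittakerKernel u w a (c + 1) s + w * whittakerKernel u w (a + 1) (c + 1) s := by
  have h0 : (1 + s * w : ℂ) ≠ 0 := slitPlane_ne_zero (one_add_ofReal_mul_mem_slitPlane hw hs.le)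
  have hs0 : (s : ℂ) ≠ 0 := by exact_mod_cast hs.ne'
  have e1 : (1 + s * w : ℂ) ^ (-c) = (1 + s * w) ^ (-(c + 1)) * (1 + s * w) := by
    nth_rw 3 [← cpow_one (1 + s * w : ℂ)]
    rw [← cpow_add _ _ h0]; ring_nf
  have e2 : (s : ℂ) ^ (a + 1 - 1) = (s : ℂ) ^ (a - 1) * s := by
    nth_rw 3 [← cpow_one (s : ℂ)]
    rw [← cpow_add _ _ hs0]; ring_nf
  simp only [whittakerKernel, e1, e2]
  ring

/-- Peeling one factor `1 + s w` off the power gives the counterpart, with the parameters exchanged,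
of the relation from integration by parts. -/
theorem integral_whittakerKernel_eq_add {u w a : ℂ} (hu : 0 < u.re) (hw : w ∈ slitPlane)
    (ha : 0 < a.re) (c : ℂ) :
    ∫ s in Set.Ioi 0, whittakerKernel u w a c s =
      (∫ s in Set.Ioi 0, whittakerKernel u w a (c + 1) s) +
        w * ∫ s in Set.Ioi 0, whittakerKernel u w (a + 1) (c + 1) s := by
  have ha1 : 0 < (a + 1).re := by simp; linarith
  rw [← integral_const_mul, ← integral_add (integrableOn_whittakerKernel hu hw ha (c + 1))
    ((integrableOn_whittakerKernel hu hw ha1 (c + 1)).const_mul w)]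
  exact setIntegral_congr_fun measurableSet_Ioi fun s hs => whittakerKernel_eq_add hw u a c hs

/-- Both arguments lie in `(-π/2, π/2)`, so their difference stays in `(-π, π)` and no branch is
crossed. -/
theorem log_mul_inv_of_re_pos {p u : ℂ} (hp : 0 < p.re) (hu : 0 < u.re) :
    log (p * u⁻¹) = log p - log u ∧ p * u⁻¹ ∈ slitPlane := by
  have hp0 : p ≠ 0 := fun h => by simp [h] at hp
  have hu0 : u ≠ 0 := fun h => by simp [h] at hu
  have h1 := abs_lt.1 (abs_arg_lt_pi_div_two_iff.2 (Or.inl hp))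
  have h2 := abs_lt.1 (abs_arg_lt_pi_div_two_iff.2 (Or.inl hu))
  have hpi : arg u ≠ Real.pi := by linarith [Real.pi_pos]
  have harg : arg u⁻¹ = -arg u := by rw [arg_inv, if_neg hpi]
  have hmem : arg p + arg u⁻¹ ∈ Set.Ioc (-Real.pi) Real.pi := by
    rw [harg]; constructor <;> linarith
  have hlog := log_mul hp0 (inv_ne_zero hu0) hmem
  refine ⟨by rw [hlog, log_inv _ hpi]; ring, ?_⟩
  rw [mem_slitPlane_iff_arg]
  refine ⟨?_, mul_ne_zero hp0 (inv_ne_zero hu0)⟩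
  rw [(arg_mul_eq_add_arg_iff hp0 (inv_ne_zero hu0)).2 hmem, harg]
  linarith

theorem mem_slitPlane_of_re_mul_pos {u w : ℂ} (hu : 0 < u.re) (huw : 0 < (u * w).re) :
    w ∈ slitPlane := by
  have hu0 : u ≠ 0 := fun h => by simp [h] at hu
  have := (log_mul_inv_of_re_pos huw hu).2
  rwa [mul_comm u w, mul_assoc, mul_inv_cancel₀ hu0, mul_one] at this

theorem re_le_re_mul_one_add {u w : ℂ} (huw : 0 < (u * w).re) {s : ℝ}
    (hs : 0 ≤ s) : u.re ≤ (u * (1 + s * w)).re := by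
  have : u * (1 + s * w) = u + s * (u * w) := by ring
  rw [this, add_re, re_ofReal_mul]
  have := mul_nonneg hs huw.le
  linarith

/-- Replacing the power by an Euler integral turns the Whittaker integral into a double integral, in
which the two parameters play equal roles. -/
theorem one_add_cpow_neg_eq_integral {u w c : ℂ} (hu : 0 < u.re) (huw : 0 < (u * w).re)
    (hc : 0 < c.re) {s : ℝ} (hs : 0 ≤ s) :
    Gamma c * (1 + s * w) ^ (-c) =
      u ^ c * ∫ t : ℝ in Set.Ioi 0, (t : ℂ) ^ (c - 1) * exp (-(t * (u * (1 + s * w)))) := by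
  have hu0 : u ≠ 0 := fun h => by simp [h] at hu
  have hp := hu.trans_le (re_le_re_mul_one_add huw hs)
  have hp0 : u * (1 + s * w) ≠ 0 := fun h => by simp [h] at hp
  rw [integral_cpow_mul_exp_neg_mul_complex hc hp]
  have h := (log_mul_inv_of_re_pos hp hu).1
  have he : u * (1 + s * w) * u⁻¹ = 1 + s * w := by field_simp
  rw [he] at h
  rw [cpow_def_of_ne_zero (right_ne_zero_of_mul hp0), cpow_def_of_ne_zero hp0,
    cpow_def_of_ne_zero hu0, h, mul_left_comm, ← exp_add]
  ring_nf

/-- The Whittaker integral, up to its normalization, is symmetric in its two parameters. -/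
theorem integral_whittakerKernel_symm {u w a c : ℂ} (hu : 0 < u.re) (huw : 0 < (u * w).re)
    (ha : 0 < a.re) (hc : 0 < c.re) :
    Gamma c * u ^ a * ∫ s in Set.Ioi 0, whittakerKernel u w a c s =
      Gamma a * u ^ c * ∫ s in Set.Ioi 0, whittakerKernel u w c a s := by
  let f : ℂ → ℂ → ℝ → ℝ → ℂ := fun a c s t =>
    (s : ℂ) ^ (a - 1) * exp (-(s * u)) * ((t : ℂ) ^ (c - 1) * exp (-(t * (u * (1 + s * w)))))
  have key : ∀ a c : ℂ, 0 < c.re →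
      Gamma c * ∫ s in Set.Ioi 0, whittakerKernel u w a c s =
        u ^ c * ∫ s in Set.Ioi (0 : ℝ), ∫ t in Set.Ioi (0 : ℝ), f a c s t := by
    intro a c hc
    rw [← integral_const_mul, ← integral_const_mul]
    refine setIntegral_congr_fun measurableSet_Ioi fun s hs => ?_
    have hs : 0 < s := hs
    simp only [f, integral_const_mul, whittakerKernel]
    rw [mul_left_comm, one_add_cpow_neg_eq_integral hu huw hc hs.le]
    ring
  -- The total exponent is `-u (s + t + s t w)`, symmetric in `s` and `t`.
  have hswap : ∀ s t : ℝ, f a c s t = f c a t s := by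
    intro s t
    simp only [f]
    rw [mul_mul_mul_comm, ← exp_add, mul_mul_mul_comm, ← exp_add, mul_comm ((s : ℂ) ^ (a - 1))]
    congr 2
    ring
  have hint : Integrable (Function.uncurry (f a c))
      ((volume.restrict (Set.Ioi (0 : ℝ))).prod (volume.restrict (Set.Ioi (0 : ℝ)))) := by
    -- Since `Re (u (1 + s w)) ≥ Re u`, the integrand is dominated by a product of two integrable
    -- functions.
    have hdom := (integrableOn_cpow_mul_exp ha hu).norm.mul_prod
      (integrableOn_cpow_mul_exp hc hu).norm
    refine hdom.mono' ?_ ?_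
    · rw [Measure.prod_restrict]
      refine ContinuousOn.aestronglyMeasurable (fun p hp => ?_)
        (measurableSet_Ioi.prod measurableSet_Ioi)
      have h1 : 0 < p.1 := hp.1
      have h2 : 0 < p.2 := hp.2
      refine ContinuousAt.continuousWithinAt ?_
      refine (ContinuousAt.mul ?_ (by fun_prop)).mul (ContinuousAt.mul ?_ (by fun_prop))
      · exact (continuousAt_ofReal_cpow_const _ _ (Or.inr h1.ne')).comp
          (f := Prod.fst) (x := p) continuousAt_fst
      · exact (continuousAt_ofReal_cpow_const _ _ (Or.inr h2.ne')).comp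
          (f := Prod.snd) (x := p) continuousAt_snd
    · rw [Measure.prod_restrict]
      filter_upwards [ae_restrict_mem (measurableSet_Ioi.prod measurableSet_Ioi)] with p hp
      have h1 : 0 < p.1 := hp.1
      have h2 : 0 < p.2 := hp.2
      simp only [Function.uncurry, f]
      rw [norm_mul, norm_ofReal_cpow_mul_exp h2, norm_ofReal_cpow_mul_exp h2]
      have hre := re_le_re_mul_one_add huw h1.le
      have hexp : Real.exp (-((u * (1 + p.1 * w)).re * p.2)) ≤ Real.exp (-(u.re * p.2)) := by
        gcongr
      exact mul_le_mul_of_nonneg_left (mul_le_mul_of_nonneg_left hexp (by positivity))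
        (norm_nonneg _)
  have h1 := key a c hc
  have h2 := key c a ha
  have h3 : ∫ s in Set.Ioi (0 : ℝ), ∫ t in Set.Ioi (0 : ℝ), f a c s t =
      ∫ s in Set.Ioi (0 : ℝ), ∫ t in Set.Ioi (0 : ℝ), f c a s t := by
    rw [integral_integral_swap hint]
    simp only [hswap]
  linear_combination u ^ a * h1 - u ^ c * h2 + u ^ a * u ^ c * h3

/-! ### The path of integration and the normalized integral -/

/-- The direction `e^{iφ}`, `φ = (arg z) / 3`, of the path of integration. -/
noncomputable def rayDir (ζ : ℂ) : ℂ := exp ((ζ.im / 3 : ℝ) * I)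

/-- The ratio `e^{iφ} / z`. -/
noncomputable def raySlope (ζ : ℂ) : ℂ := exp ((ζ.im / 3 : ℝ) * I - ζ)

theorem raySlope_eq (ζ : ℂ) : raySlope ζ = rayDir ζ * exp (-ζ) := by
  rw [raySlope, rayDir, ← exp_add, sub_eq_add_neg]

theorem cos_im_div_three_pos {ζ : ℂ} (hζ : |ζ.im| < 3 * Real.pi / 2) :
    0 < Real.cos (ζ.im / 3) := by
  rw [abs_lt] at hζ
  exact Real.cos_pos_of_mem_Ioo ⟨by linarith, by linarith⟩

theorem rayDir_re_pos {ζ : ℂ} (hζ : |ζ.im| < 3 * Real.pi / 2) : 0 < (rayDir ζ).re := by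
  rw [rayDir, exp_ofReal_mul_I_re]
  exact cos_im_div_three_pos hζ

/-- The product has argument `2φ - arg z = -φ`. With `φ = (arg z) / 3` this lies in the right half
plane together with the ray direction, throughout `|arg z| < 3π/2`. -/
theorem rayDir_mul_raySlope_re_pos {ζ : ℂ} (hζ : |ζ.im| < 3 * Real.pi / 2) :
    0 < (rayDir ζ * raySlope ζ).re := by
  have : rayDir ζ * raySlope ζ = exp ((-ζ.re : ℝ) + (-(ζ.im / 3) : ℝ) * I) := by
    rw [rayDir, raySlope, ← exp_add]
    congr 1
    push_cast
    linear_combination re_add_im ζ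
  rw [this, exp_add, ← ofReal_exp, re_ofReal_mul, exp_ofReal_mul_I_re, Real.cos_neg]
  exact mul_pos (Real.exp_pos _) (cos_im_div_three_pos hζ)

theorem raySlope_mem_slitPlane {ζ : ℂ} (hζ : |ζ.im| < 3 * Real.pi / 2) :
    raySlope ζ ∈ slitPlane :=
  mem_slitPlane_of_re_mul_pos (rayDir_re_pos hζ) (rayDir_mul_raySlope_re_pos hζ)

theorem rayDir_cpow {ζ : ℂ} (hζ : |ζ.im| < 3 * Real.pi / 2) (a : ℂ) :
    rayDir ζ ^ a = exp (a * ((ζ.im / 3 : ℝ) * I)) := by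
  rw [abs_lt] at hζ
  have him : (((ζ.im / 3 : ℝ) : ℂ) * I).im = ζ.im / 3 := by simp
  rw [rayDir, cpow_def_of_ne_zero (exp_ne_zero _), log_exp, mul_comm]
  · rw [him]; linarith [Real.pi_pos]
  · rw [him]; linarith [Real.pi_pos]

theorem whittakerIntegral_eq {ζ : ℂ} (hζ : |ζ.im| < 3 * Real.pi / 2) (a c : ℂ) :
    whittakerIntegral a c ζ = (Gamma a)⁻¹ * rayDir ζ ^ a *
      ∫ s in Set.Ioi 0, whittakerKernel (rayDir ζ) (raySlope ζ) a c s := by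
  rw [rayDir_cpow hζ]
  rfl

theorem rayDir_ne_zero (ζ : ℂ) : rayDir ζ ≠ 0 := exp_ne_zero _

theorem rayDir_cpow_add_one (ζ a : ℂ) : rayDir ζ ^ (a + 1) = rayDir ζ ^ a * rayDir ζ := by
  rw [cpow_add _ _ (rayDir_ne_zero ζ), cpow_one]

theorem whittakerIntegral_rec {ζ a : ℂ} (hζ : |ζ.im| < 3 * Real.pi / 2) (ha : 0 < a.re) (c : ℂ) :
    whittakerIntegral a c ζ =
      whittakerIntegral (a + 1) c ζ + c * exp (-ζ) * whittakerIntegral (a + 1) (c + 1) ζ := by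
  have ha0 : a ≠ 0 := fun h => by simp [h] at ha
  have hG : Gamma a ≠ 0 := Gamma_ne_zero_of_re_pos ha
  have h := integral_whittakerKernel_by_parts (rayDir_re_pos hζ) (raySlope_mem_slitPlane hζ) ha c
  simp only [whittakerIntegral_eq hζ, Gamma_add_one a ha0, rayDir_cpow_add_one]
  rw [raySlope_eq] at h ⊢
  field_simp
  linear_combination rayDir ζ ^ a * h

theorem whittakerIntegral_rec_right {ζ a : ℂ} (hζ : |ζ.im| < 3 * Real.pi / 2) (ha : 0 < a.re)
    (c : ℂ) :
    whittakerIntegral a c ζ =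
      whittakerIntegral a (c + 1) ζ + a * exp (-ζ) * whittakerIntegral (a + 1) (c + 1) ζ := by
  have ha0 : a ≠ 0 := fun h => by simp [h] at ha
  have hG : Gamma a ≠ 0 := Gamma_ne_zero_of_re_pos ha
  have h := integral_whittakerKernel_eq_add (rayDir_re_pos hζ) (raySlope_mem_slitPlane hζ) ha c
  simp only [whittakerIntegral_eq hζ, Gamma_add_one a ha0, rayDir_cpow_add_one]
  rw [raySlope_eq] at h ⊢
  field_simp
  linear_combination rayDir ζ ^ a * h

theorem whittakerIntegral_symm {ζ a c : ℂ} (hζ : |ζ.im| < 3 * Real.pi / 2) (ha : 0 < a.re)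
    (hc : 0 < c.re) : whittakerIntegral a c ζ = whittakerIntegral c a ζ := by
  have hG : Gamma a ≠ 0 := Gamma_ne_zero_of_re_pos ha
  have hG' : Gamma c ≠ 0 := Gamma_ne_zero_of_re_pos hc
  have h := integral_whittakerKernel_symm (rayDir_re_pos hζ) (rayDir_mul_raySlope_re_pos hζ) ha hc
  rw [whittakerIntegral_eq hζ, whittakerIntegral_eq hζ]
  field_simp
  linear_combination h

/-! ### Continuation in the parameters -/

/-- Once the steps carry `Re a` into the domain of convergence, a further step is just an
integration by parts. The value thus does not depend on the floor chosen in `whittakerW`. -/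
theorem whittakerAux_succ_eq {ζ : ℂ} (hζ : |ζ.im| < 3 * Real.pi / 2) (n : ℕ) {a : ℂ}
    (ha : 0 < a.re + n) (c : ℂ) : whittakerAux (n + 1) a c ζ = whittakerAux n a c ζ := by
  induction n generalizing a c with
  | zero => exact (whittakerIntegral_rec hζ (by simpa using ha) c).symm
  | succ n ih =>
    have ha1 : 0 < (a + 1).re + n := by push_cast at ha; simp; linarith
    rw [whittakerAux, ih ha1, ih ha1, whittakerAux]

theorem whittakerAux_add_eq {ζ : ℂ} (hζ : |ζ.im| < 3 * Real.pi / 2) (n k : ℕ) {a : ℂ}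
    (ha : 0 < a.re + n) (c : ℂ) : whittakerAux (n + k) a c ζ = whittakerAux n a c ζ := by
  induction k with
  | zero => rfl
  | succ k ih =>
    rw [← add_assoc, whittakerAux_succ_eq hζ _ _, ih]
    push_cast
    have : (0 : ℝ) ≤ k := k.cast_nonneg
    linarith

/-- The continuation of the Whittaker integral to all parameters. -/
noncomputable def whittakerV (a c ζ : ℂ) : ℂ := whittakerAux ⌊1 - a.re⌋₊ a c ζ

theorem whittakerAux_eq_whittakerV {ζ : ℂ} (hζ : |ζ.im| < 3 * Real.pi / 2) {n : ℕ} {a : ℂ}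
    (ha : 0 < a.re + n) (c : ℂ) : whittakerAux n a c ζ = whittakerV a c ζ := by
  have h : 0 < a.re + ⌊1 - a.re⌋₊ := by
    have := Nat.lt_floor_add_one (1 - a.re)
    linarith
  rw [whittakerV]
  rcases le_total n ⌊1 - a.re⌋₊ with hn | hn
  · obtain ⟨k, hk⟩ := Nat.exists_eq_add_of_le hn
    rw [hk, whittakerAux_add_eq hζ n k ha]
  · obtain ⟨k, hk⟩ := Nat.exists_eq_add_of_le hn
    rw [hk, whittakerAux_add_eq hζ _ k h]

theorem whittakerV_eq_whittakerIntegral {ζ : ℂ} (hζ : |ζ.im| < 3 * Real.pi / 2) {a : ℂ}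
    (ha : 0 < a.re) (c : ℂ) : whittakerV a c ζ = whittakerIntegral a c ζ :=
  (whittakerAux_eq_whittakerV hζ (n := 0) (by simpa using ha) c).symm

theorem whittakerV_rec {ζ : ℂ} (hζ : |ζ.im| < 3 * Real.pi / 2) (a c : ℂ) :
    whittakerV a c ζ =
      whittakerV (a + 1) c ζ + c * exp (-ζ) * whittakerV (a + 1) (c + 1) ζ := by
  obtain ⟨n, hn⟩ := exists_nat_gt (-a.re)
  have h1 : 0 < (a + 1).re + n := by simp; linarith
  have h2 : 0 < a.re + (n + 1 : ℕ) := by push_cast; linarith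
  rw [← whittakerAux_eq_whittakerV hζ h1, ← whittakerAux_eq_whittakerV hζ h1,
    ← whittakerAux_eq_whittakerV hζ h2, whittakerAux]

/-- The relation holds by integrals for `Re a > 0`; expanding its terms by `whittakerV_rec` carries
it one unit to the left at a time. -/
theorem whittakerV_rec_right {ζ : ℂ} (hζ : |ζ.im| < 3 * Real.pi / 2) (a c : ℂ) :
    whittakerV a c ζ =
      whittakerV a (c + 1) ζ + a * exp (-ζ) * whittakerV (a + 1) (c + 1) ζ := by
  obtain ⟨n, hn⟩ := exists_nat_gt (-a.re)
  induction n generalizing a c with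
  | zero =>
    have ha : 0 < a.re := by simpa using hn
    have ha1 : 0 < (a + 1).re := by simp; linarith
    rw [whittakerV_eq_whittakerIntegral hζ ha, whittakerV_eq_whittakerIntegral hζ ha,
      whittakerV_eq_whittakerIntegral hζ ha1]
    exact whittakerIntegral_rec_right hζ ha c
  | succ n ih =>
    have ha1 : -(a + 1).re < n := by push_cast at hn; simp; linarith
    have r1 := whittakerV_rec hζ a c
    have r2 := whittakerV_rec hζ a (c + 1)
    have r3 := whittakerV_rec hζ (a + 1) (c + 1)
    have r4 := ih (a + 1) c ha1
    have r5 := ih (a + 1) (c + 1) ha1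
    linear_combination r1 + r4 + (c * exp (-ζ)) * r5 - r2 + exp (-ζ) * r5 - a * exp (-ζ) * r3
      - exp (-ζ) * r3

/-- Exchanging the parameters exchanges the two recurrences, so symmetry spreads from `Re a, Re c >
0`, first to all `c` and then to all `a`. -/
theorem whittakerV_symm {ζ : ℂ} (hζ : |ζ.im| < 3 * Real.pi / 2) (a c : ℂ) :
    whittakerV a c ζ = whittakerV c a ζ := by
  obtain ⟨n, hn⟩ := exists_nat_gt (-a.re)
  obtain ⟨m, hm⟩ := exists_nat_gt (-c.re)
  induction n generalizing a c with
  | zero =>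
    have ha : 0 < a.re := by simpa using hn
    clear hn
    induction m generalizing a c with
    | zero =>
      have hc : 0 < c.re := by simpa using hm
      rw [whittakerV_eq_whittakerIntegral hζ ha, whittakerV_eq_whittakerIntegral hζ hc]
      exact whittakerIntegral_symm hζ ha hc
    | succ m ih =>
      have hc1 : -(c + 1).re < m := by push_cast at hm; simp; linarith
      have ha1 : 0 < (a + 1).re := by simp; linarith
      rw [whittakerV_rec_right hζ a c, whittakerV_rec hζ c a, ih _ _ hc1 ha, ih _ _ hc1 ha1]
  | succ n ih =>
    have ha1 : -(a + 1).re < n := by push_cast at hn; simp; linarith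
    have hc1 : -(c + 1).re < m := by simp; linarith
    rw [whittakerV_rec hζ a c, whittakerV_rec_right hζ c a, ih _ _ ha1 hm, ih _ _ ha1 hc1]

/-! ### Evenness and holomorphy in `μ` -/

theorem whittakerW_eq (κ μ ζ : ℂ) : whittakerW κ μ ζ = exp (-(exp ζ / 2)) * exp (κ * ζ) *
    whittakerV (1 / 2 - κ + μ) (1 / 2 - κ - μ) ζ := by
  have h1 : 1 / 2 + μ - κ = 1 / 2 - κ + μ := by ring
  have h2 : 1 / 2 - μ - κ = 1 / 2 - κ - μ := by ring
  rw [whittakerW, h1, h2, whittakerV]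

theorem whittakerW_neg {ζ : ℂ} (hζ : |ζ.im| < 3 * Real.pi / 2) (κ μ : ℂ) :
    whittakerW κ (-μ) ζ = whittakerW κ μ ζ := by
  rw [whittakerW_eq, whittakerW_eq, whittakerV_symm hζ, sub_neg_eq_add, ← sub_eq_add_neg]

theorem whittakerDeriv_odd {ζ : ℂ} (hζ : |ζ.im| < 3 * Real.pi / 2) (j : ℕ) (κ : ℂ) :
    whittakerDeriv (2 * j + 1) κ 0 ζ = 0 := by
  have h := iteratedDeriv_comp_neg (2 * j + 1) (fun μ => whittakerW κ μ ζ) 0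
  simp only [whittakerW_neg hζ, neg_zero, Odd.neg_one_pow ⟨j, rfl⟩, neg_smul, one_smul] at h
  exact self_eq_neg.1 h

theorem differentiableAt_whittakerIntegral {ζ : ℂ} (hζ : |ζ.im| < 3 * Real.pi / 2) (a c : ℂ)
    {μ : ℂ} (ha : 0 < (a + μ).re) :
    DifferentiableAt ℂ (fun μ => whittakerIntegral (a + μ) (c - μ) ζ) μ := by
  have hu := rayDir_re_pos hζ
  have hw := raySlope_mem_slitPlane hζ
  obtain ⟨C, M, hC, hCM⟩ := exists_norm_one_add_cpow_le hw (‖c - μ‖ + (a + μ).re / 2)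
  have hre : ∀ x ∈ Metric.ball μ ((a + μ).re / 2),
      (a + μ).re / 2 ≤ (a + x).re ∧ (a + x).re ≤ 2 * (a + μ).re := fun x hx => by
    have := (abs_re_le_norm (x - μ)).trans_lt (by simpa [dist_eq] using hx)
    rw [sub_re, abs_lt] at this
    simp only [add_re] at this ⊢ ha
    constructor <;> linarith
  have hK : DifferentiableAt ℂ (fun μ => ∫ s in Set.Ioi 0,
      whittakerKernel (rayDir ζ) (raySlope ζ) (a + μ) (c - μ) s) μ := by
    -- On this ball `Re (a + x)` lies between half and twice its central value. The lower power of
    -- `s` dominates for `s ≤ 1`, the higher one for `s ≥ 1`.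
    refine differentiableAt_integral_of_dominated (R := (a + μ).re / 2) (by positivity)
      (bound := fun s =>
        C * (s ^ ((a + μ).re / 2 - 1) * Real.exp (-((rayDir ζ).re * s)) * (1 + s) ^ M) +
        C * (s ^ (2 * (a + μ).re - 1) * Real.exp (-((rayDir ζ).re * s)) * (1 + s) ^ M))
      (fun x hx => ?_) ?_ ?_ ?_
    · exact (integrableOn_whittakerKernel hu hw
        ((half_pos ha).trans_le (hre x hx).1) _).aestronglyMeasurable
    · filter_upwards [ae_restrict_mem measurableSet_Ioi] with s hs x hx
      have hs : 0 < s := hs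
      rw [norm_whittakerKernel hs]
      have hpow : s ^ ((a + x).re - 1) ≤
          s ^ ((a + μ).re / 2 - 1) + s ^ (2 * (a + μ).re - 1) := by
        rcases le_total s 1 with h1 | h1
        · exact (Real.rpow_le_rpow_of_exponent_ge hs h1 (by linarith [(hre x hx).1])).trans
            (le_add_of_nonneg_right (by positivity))
        · exact (Real.rpow_le_rpow_of_exponent_le h1 (by linarith [(hre x hx).2])).trans
            (le_add_of_nonneg_left (by positivity))
      have hc : ‖c - x‖ ≤ ‖c - μ‖ + (a + μ).re / 2 := by
        have e : c - x = c - μ - (x - μ) := by ring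
        rw [e]
        refine (norm_sub_le _ _).trans ?_
        gcongr
        exact (by simpa [dist_eq] using hx : ‖x - μ‖ < (a + μ).re / 2).le
      calc _ ≤ (s ^ ((a + μ).re / 2 - 1) + s ^ (2 * (a + μ).re - 1)) *
            Real.exp (-((rayDir ζ).re * s)) * (C * (1 + s) ^ M) := by
            gcongr; exact hCM _ hc s hs.le
        _ = _ := by ring
    · exact ((integrableOn_rpow_mul_exp_mul_one_add_pow hu M (half_pos ha)).const_mul C).add
        ((integrableOn_rpow_mul_exp_mul_one_add_pow hu M (by positivity)).const_mul C)
    · filter_upwards [ae_restrict_mem measurableSet_Ioi] with s hs x hx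
      have hs : 0 < s := hs
      have h0 : (s : ℂ) ≠ 0 := by exact_mod_cast hs.ne'
      have h1 := slitPlane_ne_zero (one_add_ofReal_mul_mem_slitPlane hw hs.le)
      unfold whittakerKernel
      refine (DifferentiableAt.mul ?_ (by fun_prop)).mul ?_
      · exact DifferentiableAt.const_cpow (by fun_prop) (Or.inl h0)
      · exact DifferentiableAt.const_cpow (by fun_prop) (Or.inl h1)
  have hG : DifferentiableAt ℂ (fun μ => (Gamma (a + μ))⁻¹) μ :=
    (differentiable_one_div_Gamma (a + μ)).comp μ (f := fun μ => a + μ) (by fun_prop)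
  simp only [whittakerIntegral_eq hζ]
  refine (hG.mul ?_).mul hK
  exact DifferentiableAt.const_cpow (by fun_prop) (Or.inl (exp_ne_zero _))

theorem differentiableAt_whittakerAux {ζ : ℂ} (hζ : |ζ.im| < 3 * Real.pi / 2) (n : ℕ) (a c : ℂ)
    {μ : ℂ} (ha : 0 < (a + μ).re + n) :
    DifferentiableAt ℂ (fun μ => whittakerAux n (a + μ) (c - μ) ζ) μ := by
  induction n generalizing a c with
  | zero => exact differentiableAt_whittakerIntegral hζ a c (by simpa using ha)
  | succ n ih =>
    have ha1 : 0 < (a + 1 + μ).re + n := by push_cast at ha; simp at ha ⊢; linarith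
    have e : ∀ μ, whittakerAux (n + 1) (a + μ) (c - μ) ζ =
        whittakerAux n (a + 1 + μ) (c - μ) ζ +
          (c - μ) * exp (-ζ) * whittakerAux n (a + 1 + μ) (c + 1 - μ) ζ := fun μ => by
      rw [whittakerAux, add_right_comm a μ 1, sub_add_eq_add_sub c μ 1]
    simp only [e]
    exact (ih _ _ ha1).add ((by fun_prop : DifferentiableAt ℂ
      (fun μ => (c - μ) * exp (-ζ)) μ).mul (ih _ _ ha1))

/-- The number of steps in `whittakerV` jumps with `μ`, but near a given `μ` one fixed number
serves. -/
theorem differentiable_whittakerV {ζ : ℂ} (hζ : |ζ.im| < 3 * Real.pi / 2) (a c : ℂ) :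
    Differentiable ℂ (fun μ => whittakerV (a + μ) (c - μ) ζ) := by
  intro μ
  obtain ⟨n, hn⟩ := exists_nat_gt (-(a + μ).re)
  refine (differentiableAt_whittakerAux hζ n a c (by linarith)).congr_of_eventuallyEq ?_
  have hopen : IsOpen {x : ℂ | 0 < (a + x).re + n} :=
    isOpen_lt continuous_const (by fun_prop)
  filter_upwards [hopen.mem_nhds (by simp only [Set.mem_ofPred_eq]; linarith)] with x hx
  exact (whittakerAux_eq_whittakerV hζ hx _).symm

/-! ### Taylor remainder of the binomial -/

/-- The Taylor coefficient at `w = 0` of `(1 + w)^{-c}`. -/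
noncomputable def negBinomCoeff (k : ℕ) (c : ℂ) : ℂ :=
  (-1) ^ k * (ascPochhammer ℂ k).eval c / k.factorial

theorem negBinomCoeff_zero (c : ℂ) : negBinomCoeff 0 c = 1 := by simp [negBinomCoeff]

theorem negBinomCoeff_succ_mul (k : ℕ) (c : ℂ) :
    negBinomCoeff (k + 1) c * (k + 1) = -c * negBinomCoeff k (c + 1) := by
  have h1 : (k + 1 : ℂ) ≠ 0 := by exact_mod_cast k.succ_ne_zero
  have h2 : (k.factorial : ℂ) ≠ 0 := by exact_mod_cast k.factorial_ne_zero
  simp only [negBinomCoeff, ascPochhammer_succ_left, Polynomial.eval_mul, Polynomial.eval_X,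
    Polynomial.eval_comp, Polynomial.eval_add, Polynomial.eval_one, Nat.factorial_succ,
    Nat.cast_mul, Nat.cast_add, Nat.cast_one, pow_succ]
  field_simp

/-- Taylor remainder of `(1 + y w)^{-c}` as a function of `y`. -/
noncomputable def negBinomRemainder (N : ℕ) (c w : ℂ) (y : ℝ) : ℂ :=
  (1 + y * w) ^ (-c) - ∑ k ∈ Finset.range N, negBinomCoeff k c * (y * w) ^ k

theorem hasDerivAt_negBinomRemainder_succ {w : ℂ} (hw : w ∈ slitPlane) (N : ℕ) (c : ℂ) {y : ℝ}
    (hy : 0 ≤ y) : HasDerivAt (negBinomRemainder (N + 1) c w)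
      (-c * w * negBinomRemainder N (c + 1) w y) y := by
  have hsl := one_add_ofReal_mul_mem_slitPlane hw hy
  have h1 : HasDerivAt (fun y : ℝ => (1 + y * w) ^ (-c))
      (-c * (1 + y * w) ^ (-c - 1) * (1 * w)) y :=
    ((((hasDerivAt_id (y : ℂ)).mul_const w).const_add 1).cpow_const hsl).comp_ofReal
  have h2 : ∀ k, HasDerivAt (fun y : ℝ => negBinomCoeff (k + 1) c * (y * w) ^ (k + 1))
      (negBinomCoeff (k + 1) c * (((k + 1 : ℕ) : ℂ) * (y * w) ^ k * (1 * w))) y := fun k =>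
    ((((hasDerivAt_id (y : ℂ)).mul_const w).pow (k + 1)).const_mul _).comp_ofReal
  have h3 := h1.sub ((HasDerivAt.fun_sum (u := Finset.range N) fun k _ => h2 k).add_const 1)
  have he : negBinomRemainder (N + 1) c w = (fun y : ℝ => (1 + y * w) ^ (-c)) -
      fun y : ℝ => (∑ k ∈ Finset.range N, negBinomCoeff (k + 1) c * (y * w) ^ (k + 1)) + 1 := by
    ext y
    simp [negBinomRemainder, Finset.sum_range_succ', negBinomCoeff_zero]
  rw [he]
  refine h3.congr_deriv ?_
  rw [negBinomRemainder, mul_sub, Finset.mul_sum]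
  congr 1
  · rw [show -(c + 1) = -c - 1 by ring]; ring
  · refine Finset.sum_congr rfl fun k _ => ?_
    have := negBinomCoeff_succ_mul k c
    push_cast
    linear_combination (y * w) ^ k * w * this

/-- Differentiation lowers the order by one and replaces `c` by `c + 1`; the remainder vanishes at
`0`, so the mean value inequality gains one factor `y` per order. For `N = 0` the sum is empty. -/
theorem exists_norm_negBinomRemainder_le {w : ℂ} (hw : w ∈ slitPlane) (N : ℕ) (B : ℝ) :
    ∃ (C : ℝ) (M : ℕ), 0 ≤ C ∧ ∀ c : ℂ, ‖c‖ ≤ B → ∀ y : ℝ, 0 ≤ y →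
      ‖negBinomRemainder N c w y‖ ≤ C * y ^ N * (1 + y) ^ M := by
  induction N generalizing B with
  | zero => simpa [negBinomRemainder] using exists_norm_one_add_cpow_le hw B
  | succ N ih =>
    obtain ⟨C, M, hC, h⟩ := ih (B + 1)
    refine ⟨|B| * ‖w‖ * C, M, by positivity, fun c hc y hy => ?_⟩
    have h0 : negBinomRemainder (N + 1) c w 0 = 0 := by
      simp [negBinomRemainder, Finset.sum_range_succ', negBinomCoeff_zero]
    have hmv := (convex_Icc 0 y).norm_image_sub_le_of_norm_hasDerivWithin_le
      (f := negBinomRemainder (N + 1) c w) (C := |B| * ‖w‖ * (C * y ^ N * (1 + y) ^ M))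
      (fun t ht => (hasDerivAt_negBinomRemainder_succ hw N c ht.1).hasDerivWithinAt)
      (fun t ht => ?_) (Set.left_mem_Icc.2 hy) (Set.right_mem_Icc.2 hy)
    · rw [h0, sub_zero, sub_zero, Real.norm_of_nonneg hy] at hmv
      refine hmv.trans_eq ?_
      ring
    · have ht0 : 0 ≤ t := ht.1
      have hty : t ≤ y := ht.2
      rw [norm_mul, norm_mul, norm_neg]
      have hcB : ‖c‖ ≤ |B| := hc.trans (le_abs_self B)
      have hc1 : ‖c + 1‖ ≤ B + 1 := (norm_add_le _ _).trans (by simpa using hc)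
      have : ‖negBinomRemainder N (c + 1) w t‖ ≤ C * y ^ N * (1 + y) ^ M :=
        (h _ hc1 t ht0).trans (by gcongr)
      gcongr

/-! ### Asymptotic expansion, uniform in the parameters -/

/-- The coefficients of the asymptotic expansion of the Whittaker integral in powers of `1/z`. -/
noncomputable def whittakerCoeff (k : ℕ) (a c : ℂ) : ℂ :=
  (-1) ^ k * (ascPochhammer ℂ k).eval a * (ascPochhammer ℂ k).eval c / k.factorial

theorem whittakerCoeff_zero (a c : ℂ) : whittakerCoeff 0 a c = 1 := by simp [whittakerCoeff]

/-- This mirrors the recursion defining `whittakerAux`, so the expansion survives each step of the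
continuation. -/
theorem whittakerCoeff_succ_rec (k : ℕ) (a c : ℂ) :
    whittakerCoeff (k + 1) a c =
      whittakerCoeff (k + 1) (a + 1) c + c * whittakerCoeff k (a + 1) (c + 1) := by
  have h1 : (k + 1 : ℂ) ≠ 0 := by exact_mod_cast k.succ_ne_zero
  have h2 : (k.factorial : ℂ) ≠ 0 := by exact_mod_cast k.factorial_ne_zero
  have e1 : (ascPochhammer ℂ (k + 1)).eval a = a * (ascPochhammer ℂ k).eval (a + 1) := by
    simp [ascPochhammer_succ_left, Polynomial.eval_comp]
  have e2 : (ascPochhammer ℂ (k + 1)).eval c = c * (ascPochhammer ℂ k).eval (c + 1) := by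
    simp [ascPochhammer_succ_left, Polynomial.eval_comp]
  have e3 : (ascPochhammer ℂ (k + 1)).eval (a + 1) =
      (ascPochhammer ℂ k).eval (a + 1) * (a + 1 + k) := ascPochhammer_succ_eval k (a + 1)
  simp only [whittakerCoeff, e1, e2, e3, Nat.factorial_succ, Nat.cast_mul, Nat.cast_add,
    Nat.cast_one, pow_succ]
  field_simp
  ring

theorem integral_cpow_mul_exp_mul_pow {a u : ℂ} (ha : 0 < a.re) (hu : 0 < u.re) (x : ℂ) (k : ℕ) :
    IntegrableOn (fun s : ℝ => (s : ℂ) ^ (a - 1) * exp (-(s * u)) * (s * x) ^ k) (Set.Ioi 0) ∧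
    ∫ s : ℝ in Set.Ioi 0, (s : ℂ) ^ (a - 1) * exp (-(s * u)) * (s * x) ^ k =
      x ^ k * (Gamma (a + k) * u ^ (-(a + k))) := by
  have hak : 0 < (a + k).re := by simp; positivity
  have he : Set.EqOn (fun s : ℝ => x ^ k * ((s : ℂ) ^ (a + k - 1) * exp (-(s * u))))
      (fun s : ℝ => (s : ℂ) ^ (a - 1) * exp (-(s * u)) * (s * x) ^ k) (Set.Ioi 0) := by
    intro s hs
    have hs : 0 < s := hs
    have hs0 : (s : ℂ) ≠ 0 := by exact_mod_cast hs.ne'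
    have : (s : ℂ) ^ (a + k - 1) = (s : ℂ) ^ (a - 1) * (s : ℂ) ^ k := by
      rw [← cpow_natCast, ← cpow_add _ _ hs0]; ring_nf
    simp only [this, mul_pow]
    ring
  have hi : IntegrableOn (fun s : ℝ => x ^ k * ((s : ℂ) ^ (a + k - 1) * exp (-(s * u))))
      (Set.Ioi 0) := (integrableOn_cpow_mul_exp hak hu).const_mul _
  refine ⟨hi.congr_fun he measurableSet_Ioi, ?_⟩
  rw [← setIntegral_congr_fun measurableSet_Ioi he, integral_const_mul,
    integral_cpow_mul_exp_neg_mul_complex hak hu]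

theorem polarLog_im (r θ : ℝ) : (polarLog r θ).im = θ := by simp [polarLog]

theorem exp_polarLog {r : ℝ} (hr : 0 < r) (θ : ℝ) : exp (polarLog r θ) = r * exp (θ * I) := by
  rw [polarLog, exp_add, ← ofReal_exp, Real.exp_log hr]

theorem exp_neg_polarLog {r : ℝ} (hr : 0 < r) (θ : ℝ) :
    exp (-polarLog r θ) = (r⁻¹ : ℝ) * exp (-(θ * I)) := by
  rw [exp_neg, exp_polarLog hr, exp_neg, mul_inv, ofReal_inv]

theorem norm_exp_neg_polarLog {r : ℝ} (hr : 0 < r) (θ : ℝ) :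
    ‖exp (-polarLog r θ)‖ = r⁻¹ := by
  rw [exp_neg, exp_polarLog hr, norm_inv, norm_mul, norm_exp_ofReal_mul_I, mul_one, norm_real,
    Real.norm_of_nonneg hr.le]

theorem rayDir_polarLog (r θ : ℝ) : rayDir (polarLog r θ) = rayDir (θ * I) := by
  simp [rayDir, polarLog_im]

theorem raySlope_polarLog {r : ℝ} (hr : 0 < r) (θ : ℝ) :
    raySlope (polarLog r θ) = (r⁻¹ : ℝ) * raySlope (θ * I) := by
  rw [raySlope_eq, raySlope_eq, rayDir_polarLog, exp_neg_polarLog hr]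
  ring

/-- The expansion of the Whittaker integral with its remainder. -/
theorem whittakerIntegral_sub_sum_eq {θ r : ℝ} (hθ : |θ| < 3 * Real.pi / 2) (hr : 0 < r) {a : ℂ}
    (ha : 0 < a.re) (c : ℂ) (N : ℕ) :
    whittakerIntegral a c (polarLog r θ) -
        ∑ k ∈ Finset.range N, whittakerCoeff k a c * exp (-polarLog r θ) ^ k =
      (Gamma a)⁻¹ * rayDir (θ * I) ^ a *
        ∫ s : ℝ in Set.Ioi 0, (s : ℂ) ^ (a - 1) * exp (-(s * rayDir (θ * I))) *
          negBinomRemainder N c (raySlope (θ * I)) (s * r⁻¹) := by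
  have hζ : |(polarLog r θ).im| < 3 * Real.pi / 2 := by rwa [polarLog_im]
  have hθI : |((θ : ℂ) * I).im| < 3 * Real.pi / 2 := by simpa using hθ
  set u := rayDir (θ * I) with hu
  set x := raySlope (polarLog r θ) with hx
  have hure : 0 < u.re := rayDir_re_pos hθI
  have hu0 : u ≠ 0 := rayDir_ne_zero _
  have hG : Gamma a ≠ 0 := Gamma_ne_zero_of_re_pos ha
  have hK := integrableOn_whittakerKernel hure (raySlope_mem_slitPlane hζ) ha c
  have hP := fun k => integral_cpow_mul_exp_mul_pow ha hure x k
  have e1 : ∀ s : ℝ, (s : ℂ) ^ (a - 1) * exp (-(s * u)) *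
      negBinomRemainder N c (raySlope (θ * I)) (s * r⁻¹) =
      whittakerKernel u x a c s - ∑ k ∈ Finset.range N, negBinomCoeff k c *
        ((s : ℂ) ^ (a - 1) * exp (-(s * u)) * (s * x) ^ k) := fun s => by
    rw [negBinomRemainder, whittakerKernel, mul_sub, Finset.mul_sum, hx, raySlope_polarLog hr,
      ofReal_mul, mul_assoc (s : ℂ)]
    congr 1
    exact Finset.sum_congr rfl fun k _ => by ring
  simp only [e1]
  rw [integral_sub hK (integrable_finsetSum _ fun k _ => (hP k).1.const_mul _),
    integral_finsetSum _ fun k _ => (hP k).1.const_mul _, mul_sub, whittakerIntegral_eq hζ,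
    rayDir_polarLog, Finset.mul_sum]
  congr 1
  refine Finset.sum_congr rfl fun k _ => ?_
  -- As `x = u / z`, the powers of `u` cancel in `u^a x^k u^{-(a+k)}`, leaving `z^{-k}`.
  have hxe : x = u * exp (-polarLog r θ) := by rw [hx, raySlope_eq, rayDir_polarLog]
  have hGk : Gamma (a + k) = (ascPochhammer ℂ k).eval a * Gamma a := by
    rw [← Gamma_add_nat_div_Gamma_eq a fun k h => ?_, div_mul_cancel₀ _ hG]
    rw [h] at ha
    simp only [neg_re, natCast_re] at ha
    linarith [k.cast_nonneg (α := ℝ)]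
  rw [integral_const_mul, (hP k).2, hGk, hxe, cpow_neg, cpow_add _ _ hu0, cpow_natCast,
    whittakerCoeff, negBinomCoeff, mul_pow]
  have hua : u ^ a ≠ 0 := by simp [cpow_eq_zero_iff, hu0]
  field_simp

/-- The remainder at `s / r` supplies `r⁻¹ ^ N` times a polynomial in `s`, which the exponential
absorbs. Uniformity uses that `1 / Γ` is entire and that `Re a ≥ 1` keeps the power of `s` bounded
near `0`. -/
theorem exists_norm_whittakerIntegral_sub_le {θ : ℝ} (hθ : |θ| < 3 * Real.pi / 2) (N : ℕ)
    (A : ℝ) : ∃ C : ℝ, 0 ≤ C ∧ ∀ a c : ℂ, 1 ≤ a.re → ‖a‖ ≤ A → ‖c‖ ≤ A → ∀ r : ℝ, 1 ≤ r →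
      ‖whittakerIntegral a c (polarLog r θ) -
        ∑ k ∈ Finset.range N, whittakerCoeff k a c * exp (-polarLog r θ) ^ k‖ ≤ C * r⁻¹ ^ N := by
  have hθI : |((θ : ℂ) * I).im| < 3 * Real.pi / 2 := by simpa using hθ
  have hure := rayDir_re_pos hθI
  obtain ⟨C, M, hC, hCM⟩ :=
    exists_norm_negBinomRemainder_le (raySlope_mem_slitPlane hθI) N A
  obtain ⟨G, hG⟩ := (isCompact_closedBall (0 : ℂ) A).exists_bound_of_continuousOn
    (f := fun a => (Gamma a)⁻¹ * rayDir (θ * I) ^ a) (Continuous.continuousOn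
      (differentiable_one_div_Gamma.continuous.mul
        (continuous_id.const_cpow (Or.inl (rayDir_ne_zero _)))))
  set k := (rayDir (θ * I)).re with hk
  have hA : (0 : ℝ) < |A| + 1 := by positivity
  have i1 := integrableOn_rpow_mul_exp_mul_one_add_pow hure (N + M) one_pos
  have i2 := integrableOn_rpow_mul_exp_mul_one_add_pow hure (N + M) hA
  set S : ℝ := ∫ s in Set.Ioi (0 : ℝ),
    (s ^ ((1 : ℝ) - 1) * Real.exp (-(k * s)) * (1 + s) ^ (N + M) +
      s ^ (|A| + 1 - 1) * Real.exp (-(k * s)) * (1 + s) ^ (N + M)) with hS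
  have hS0 : 0 ≤ S := setIntegral_nonneg measurableSet_Ioi fun s hs => by
    have hs : 0 < s := hs
    positivity
  refine ⟨|G| * (C * S), by positivity, fun a c ha haA hcA r hr => ?_⟩
  have hr0 : 0 < r := by linarith
  have hx0 : 0 ≤ r⁻¹ := by positivity
  have hx1 : r⁻¹ ≤ 1 := inv_le_one_of_one_le₀ hr
  rw [whittakerIntegral_sub_sum_eq hθ hr0 (by linarith), norm_mul]
  have h1 := (hG a (by simpa using haA)).trans (le_abs_self G)
  have h2 : ‖∫ s : ℝ in Set.Ioi 0, (s : ℂ) ^ (a - 1) * exp (-(s * rayDir (θ * I))) *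
      negBinomRemainder N c (raySlope (θ * I)) (s * r⁻¹)‖ ≤ C * r⁻¹ ^ N * S := by
    rw [hS, ← integral_const_mul]
    refine norm_integral_le_of_norm_le ((i1.add i2).const_mul _) ?_
    filter_upwards [ae_restrict_mem measurableSet_Ioi] with s hs
    have hs : 0 < s := hs
    rw [norm_mul, norm_ofReal_cpow_mul_exp hs]
    have hpow : s ^ (a.re - 1) ≤ s ^ ((1 : ℝ) - 1) + s ^ (|A| + 1 - 1) := by
      have haA' : a.re ≤ |A| := (re_le_norm a).trans (haA.trans (le_abs_self A))
      rcases le_total s 1 with h | h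
      · exact (Real.rpow_le_rpow_of_exponent_ge hs h (by linarith)).trans
          (le_add_of_nonneg_right (by positivity))
      · exact (Real.rpow_le_rpow_of_exponent_le h (by linarith)).trans
          (le_add_of_nonneg_left (by positivity))
    have hrem : ‖negBinomRemainder N c (raySlope (θ * I)) (s * r⁻¹)‖ ≤
        C * r⁻¹ ^ N * (1 + s) ^ (N + M) := by
      refine (hCM c hcA (s * r⁻¹) (by positivity)).trans ?_
      have hb : s * r⁻¹ ≤ s := mul_le_of_le_one_right hs.le hx1
      calc C * (s * r⁻¹) ^ N * (1 + s * r⁻¹) ^ M ≤ C * ((1 + s) * r⁻¹) ^ N * (1 + s) ^ M := by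
            gcongr; linarith
        _ = _ := by rw [mul_pow, pow_add]; ring
    calc _ ≤ (s ^ ((1 : ℝ) - 1) + s ^ (|A| + 1 - 1)) * Real.exp (-(k * s)) *
          (C * r⁻¹ ^ N * (1 + s) ^ (N + M)) := by gcongr
      _ = _ := by ring
  calc _ ≤ |G| * (C * r⁻¹ ^ N * S) := mul_le_mul h1 h2 (norm_nonneg _) (abs_nonneg _)
    _ = _ := by ring

theorem exists_norm_whittakerAux_sub_le {θ : ℝ} (hθ : |θ| < 3 * Real.pi / 2) (n N : ℕ)
    (A : ℝ) : ∃ C : ℝ, 0 ≤ C ∧ ∀ a c : ℂ, 1 ≤ a.re + n → ‖a‖ ≤ A → ‖c‖ ≤ A → ∀ r : ℝ, 1 ≤ r →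
      ‖whittakerAux n a c (polarLog r θ) -
        ∑ k ∈ Finset.range N, whittakerCoeff k a c * exp (-polarLog r θ) ^ k‖ ≤ C * r⁻¹ ^ N := by
  induction n generalizing N A with
  | zero => simpa [whittakerAux] using exists_norm_whittakerIntegral_sub_le hθ N A
  | succ n ih =>
    obtain ⟨C₁, hC₁, h₁⟩ := ih N (A + 1)
    -- The second term carries a factor `1 / z`, so order `N - 1` suffices. For `N = 0` the
    -- truncated subtraction is harmless because `r⁻¹ ≤ 1`.
    obtain ⟨C₂, hC₂, h₂⟩ := ih (N - 1) (A + 1)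
    refine ⟨C₁ + |A| * C₂, by positivity, fun a c ha haA hcA r hr => ?_⟩
    have hr0 : 0 < r := by linarith
    have hx1 : r⁻¹ ≤ 1 := inv_le_one_of_one_le₀ hr
    have ha1 : 1 ≤ (a + 1).re + n := by push_cast at ha; simp; linarith
    have haA1 : ‖a + 1‖ ≤ A + 1 := (norm_add_le _ _).trans (by simpa using haA)
    have hcA1 : ‖c + 1‖ ≤ A + 1 := (norm_add_le _ _).trans (by simpa using hcA)
    have b₁ := h₁ (a + 1) c ha1 haA1 (by linarith) r hr
    have b₂ := h₂ (a + 1) (c + 1) ha1 haA1 hcA1 r hr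
    set Z := exp (-polarLog r θ) with hZ
    have hZn : ‖Z‖ = r⁻¹ := norm_exp_neg_polarLog hr0 θ
    have hsum : ∑ k ∈ Finset.range N, whittakerCoeff k a c * Z ^ k =
        ∑ k ∈ Finset.range N, whittakerCoeff k (a + 1) c * Z ^ k +
          c * Z * ∑ k ∈ Finset.range (N - 1), whittakerCoeff k (a + 1) (c + 1) * Z ^ k := by
      cases N with
      | zero => simp
      | succ N =>
        simp only [Finset.sum_range_succ', whittakerCoeff_zero, Nat.add_sub_cancel,
          Finset.mul_sum, whittakerCoeff_succ_rec _ a c, add_mul, Finset.sum_add_distrib]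
        rw [add_right_comm]
        congr 1
        exact Finset.sum_congr rfl fun k _ => by ring
    have hpow : r⁻¹ * r⁻¹ ^ (N - 1) ≤ r⁻¹ ^ N := by
      cases N with
      | zero => simpa using hx1
      | succ N => rw [Nat.add_sub_cancel, pow_succ, mul_comm]
    rw [whittakerAux, hsum, add_sub_add_comm, ← mul_sub]
    refine (norm_add_le _ _).trans ?_
    rw [norm_mul, norm_mul, hZn, add_mul]
    refine add_le_add b₁ ?_
    calc _ ≤ |A| * r⁻¹ * (C₂ * r⁻¹ ^ (N - 1)) := by
          gcongr; exact hcA.trans (le_abs_self A)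
      _ = |A| * C₂ * (r⁻¹ * r⁻¹ ^ (N - 1)) := by ring
      _ ≤ _ := by gcongr

/-- The asymptotic expansion of `whittakerV`, locally uniformly in the parameter. -/
theorem exists_norm_whittakerV_sub_le {θ : ℝ} (hθ : |θ| < 3 * Real.pi / 2) (N : ℕ)
    (a c μ₀ : ℂ) : ∃ C : ℝ, 0 ≤ C ∧ ∀ μ ∈ Metric.closedBall μ₀ 1, ∀ r : ℝ, 1 ≤ r →
      ‖whittakerV (a + μ) (c - μ) (polarLog r θ) -
        ∑ k ∈ Finset.range N, whittakerCoeff k (a + μ) (c - μ) * exp (-polarLog r θ) ^ k‖ ≤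
          C * r⁻¹ ^ N := by
  -- The `2` allows for a drop of `1` in `Re μ` on the disc and leaves the margin `1`.
  obtain ⟨n, hn⟩ := exists_nat_ge (2 - (a + μ₀).re)
  obtain ⟨C, hC, h⟩ := exists_norm_whittakerAux_sub_le hθ n N (‖a‖ + ‖c‖ + ‖μ₀‖ + 1)
  refine ⟨C, hC, fun μ hμ r hr => ?_⟩
  rw [mem_closedBall_iff_norm] at hμ
  have hre : 1 ≤ (a + μ).re + n := by
    have := (abs_re_le_norm (μ - μ₀)).trans hμ
    rw [sub_re, abs_le] at this
    simp only [add_re] at hn ⊢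
    linarith
  have hμn : ‖μ‖ ≤ ‖μ₀‖ + 1 := by
    have := norm_le_norm_add_norm_sub' μ μ₀
    linarith
  rw [← whittakerAux_eq_whittakerV (n := n) (by rwa [polarLog_im]) (by linarith)]
  refine h _ _ hre ((norm_add_le _ _).trans ?_) ((norm_sub_le _ _).trans ?_) r hr
  · linarith [norm_nonneg c]
  · linarith [norm_nonneg a]

/-! ### Algebra of the coefficient polynomials -/

/-- The coefficients of the asymptotic expansion of `W_{κ,μ}` as polynomials in `μ`. -/
noncomputable def whittakerPoly (κ : ℂ) : ℕ → Polynomial ℂ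
  | 0 => 1
  | k + 1 => Polynomial.C (-((k : ℂ) + 1)⁻¹) *
      (Polynomial.C ((1 / 2 - κ + k) ^ 2) - Polynomial.X ^ 2) * whittakerPoly κ k

/-- With `a, c = 1/2 - κ ± μ`, the factor `(a + k)(c + k)` is `(1/2 - κ + k)² - μ²`. -/
theorem eval_whittakerPoly (κ μ : ℂ) (k : ℕ) : (whittakerPoly κ k).eval μ =
    whittakerCoeff k (1 / 2 - κ + μ) (1 / 2 - κ - μ) := by
  induction k with
  | zero => simp [whittakerPoly, whittakerCoeff_zero]
  | succ k ih =>
    have h1 : (k + 1 : ℂ) ≠ 0 := by exact_mod_cast k.succ_ne_zero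
    have h2 : (k.factorial : ℂ) ≠ 0 := by exact_mod_cast k.factorial_ne_zero
    rw [whittakerPoly, Polynomial.eval_mul, ih]
    simp only [whittakerCoeff, ascPochhammer_succ_eval, Nat.factorial_succ, Nat.cast_mul,
      Nat.cast_add, Nat.cast_one, pow_succ, Polynomial.eval_mul, Polynomial.eval_C,
      Polynomial.eval_sub, Polynomial.eval_X, pow_zero, Polynomial.eval_one]
    field_simp
    ring

theorem iteratedDeriv_polynomial_eval (n : ℕ) (p : Polynomial ℂ) :
    iteratedDeriv n (fun x => p.eval x) = fun x => (Polynomial.derivative^[n] p).eval x := by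
  induction n with
  | zero => simp
  | succ n ih =>
    rw [iteratedDeriv_succ, ih, Function.iterate_succ_apply']
    ext x
    exact Polynomial.deriv _

/-- The functional `P ↦ ∑ i, c i * P^{(J i)}(μ₀)` on polynomials. -/
noncomputable def derivFunctional {ι : Type*} [Fintype ι] (J : ι → ℕ) (c : ι → ℂ) (μ₀ : ℂ) :
    Polynomial ℂ →ₗ[ℂ] ℂ :=
  ∑ i, c i • (Polynomial.leval μ₀ ∘ₗ (Polynomial.derivative ^ J i))

theorem derivFunctional_apply {ι : Type*} [Fintype ι] (J : ι → ℕ) (c : ι → ℂ) (μ₀ : ℂ)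
    (P : Polynomial ℂ) : derivFunctional J c μ₀ P =
      ∑ i, c i * (Polynomial.derivative^[J i] P).eval μ₀ := by
  simp [derivFunctional, Polynomial.leval, Module.End.pow_apply]

/-- The recurrence writes `(X² - μ₀²) P_k` as a combination of `P_k` and `P_{k+1}`, so the span of
the `P_k` is stable under this multiplication. -/
theorem map_sq_sub_sq_pow_mul_whittakerPoly_eq_zero (Λ : Polynomial ℂ →ₗ[ℂ] ℂ) (κ μ₀ : ℂ)
    (h : ∀ k, Λ (whittakerPoly κ k) = 0) (n k : ℕ) :
    Λ ((Polynomial.X ^ 2 - Polynomial.C (μ₀ ^ 2)) ^ n * whittakerPoly κ k) = 0 := by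
  induction n generalizing k with
  | zero => simpa using h k
  | succ n ih =>
    have h1 : (k + 1 : ℂ) ≠ 0 := by exact_mod_cast k.succ_ne_zero
    set D : Polynomial ℂ := Polynomial.X ^ 2 - Polynomial.C (μ₀ ^ 2) with hD
    have hrec : D ^ (n + 1) * whittakerPoly κ k =
        ((1 / 2 - κ + k) ^ 2 - μ₀ ^ 2) • (D ^ n * whittakerPoly κ k) +
          ((k : ℂ) + 1) • (D ^ n * whittakerPoly κ (k + 1)) := by
      have hc : Polynomial.C ((k : ℂ) + 1) * Polynomial.C (-((k : ℂ) + 1)⁻¹) = -1 := by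
        rw [← Polynomial.C_mul, mul_neg, mul_inv_cancel₀ h1]
        simp
      rw [Polynomial.smul_eq_C_mul, Polynomial.smul_eq_C_mul, whittakerPoly, pow_succ,
        Polynomial.C_sub]
      linear_combination (-(Polynomial.C ((1 / 2 - κ + (k : ℂ)) ^ 2) - Polynomial.X ^ 2) * D ^ n *
        whittakerPoly κ k) * hc + D ^ n * whittakerPoly κ k * hD
    rw [hrec, map_add, map_smul, map_smul, ih, ih]
    simp

/-- Derivatives at `μ₀` are Taylor coefficients there, and the shift by `μ₀` turns `X² - μ₀²` into
`X (X + 2μ₀)`. -/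
theorem eval_iterate_derivative_sq_sub_sq_pow (μ₀ : ℂ) (n j : ℕ) :
    (Polynomial.derivative^[j] ((Polynomial.X ^ 2 - Polynomial.C (μ₀ ^ 2)) ^ n)).eval μ₀ =
      j.factorial * (Polynomial.X ^ n *
        (Polynomial.X + Polynomial.C (2 * μ₀)) ^ n : Polynomial ℂ).coeff j := by
  rw [← Polynomial.factorial_smul_hasseDeriv, LinearMap.smul_apply, Polynomial.eval_smul,
    ← Polynomial.taylor_coeff, nsmul_eq_mul]
  congr 2
  rw [Polynomial.taylor_pow, ← mul_pow]
  congr 1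
  simp only [map_sub, Polynomial.taylor_C, Polynomial.taylor_pow, Polynomial.taylor_X,
    Polynomial.C_mul, Polynomial.C_pow]
  rw [show (Polynomial.C (2 : ℂ)) = 2 from rfl]
  ring

/-- A combination of derivatives at `μ₀` that kills all the polynomials `whittakerPoly κ k` is
trivial, up to the odd-order derivatives at `μ₀ = 0`. -/
theorem eq_zero_of_derivFunctional_whittakerPoly_eq_zero {ι : Type*} [Fintype ι] {J : ι → ℕ}
    (hJ : Function.Injective J) {c : ι → ℂ} {κ μ₀ : ℂ}
    (h : ∀ k, derivFunctional J c μ₀ (whittakerPoly κ k) = 0) (i : ι)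
    (hi : μ₀ ≠ 0 ∨ Even (J i)) : c i = 0 := by
  have key : ∀ n, ∑ i, c i * ((J i).factorial * (Polynomial.X ^ n *
      (Polynomial.X + Polynomial.C (2 * μ₀)) ^ n : Polynomial ℂ).coeff (J i)) = 0 := by
    intro n
    have := map_sq_sub_sq_pow_mul_whittakerPoly_eq_zero _ κ μ₀ h n 0
    rw [whittakerPoly, mul_one, derivFunctional_apply] at this
    simpa only [eval_iterate_derivative_sq_sub_sq_pow] using this
  have hf : ∀ j : ℕ, (j.factorial : ℂ) ≠ 0 := fun j => by exact_mod_cast j.factorial_ne_zero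
  by_cases h0 : μ₀ = 0
  -- The test polynomial is `X^{2n}` with `2n = J i`; only the derivative of that order survives at
  -- `0`.
  · obtain ⟨n, hn⟩ := hi.resolve_left (not_not.2 h0)
    have := key n
    rw [Finset.sum_eq_single i] at this
    · simpa [h0, hn, ← pow_add, hf] using this
    · intro b _ hb
      have hne : J b ≠ n + n := fun e => hb (hJ (e.trans hn.symm))
      simp [h0, ← pow_add, Polynomial.coeff_X_pow, hne]
    · simp
  · by_contra hci
    -- Test with the power `n = J b`, the highest order present: its zero at `μ₀` has order exactly
    -- `n`, so all lower derivatives drop out.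
    obtain ⟨b, hb, hmax⟩ := (Finset.univ.filter fun i => c i ≠ 0).exists_max_image J
      ⟨i, by simpa using hci⟩
    have hb' : c b ≠ 0 := by simpa using hb
    have := key (J b)
    rw [Finset.sum_eq_single b] at this
    · have hcoeff : (Polynomial.X ^ J b *
          (Polynomial.X + Polynomial.C (2 * μ₀)) ^ J b : Polynomial ℂ).coeff (J b) =
          (2 * μ₀) ^ J b := by
        have := Polynomial.coeff_X_pow_mul
          ((Polynomial.X + Polynomial.C (2 * μ₀)) ^ J b : Polynomial ℂ) (J b) 0
        rw [zero_add] at this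
        rw [this, Polynomial.coeff_zero_eq_eval_zero]
        simp
      rw [hcoeff] at this
      simp [hb', hf, h0] at this
    · intro d _ hd
      by_cases hcd : c d = 0
      · simp [hcd]
      · have hlt : J d < J b :=
          lt_of_le_of_ne (hmax d (by simpa using hcd)) fun e => hd (hJ e)
        rw [Polynomial.coeff_X_pow_mul', if_neg (by omega)]
        simp
    · simp

/-! ### Asymptotics of combinations of `μ`-derivatives -/

/-- A linear combination of derivatives of `W_{κ,μ}` with respect to `μ`. -/
noncomputable def whittakerComb {ι : Type*} [Fintype ι] (J : ι → ℕ) (c : ι → ℂ) (κ μ₀ ζ : ℂ) : ℂ :=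
  ∑ i, c i * whittakerDeriv (J i) κ μ₀ ζ

/-- The combination of derivatives with the factor `e^{-z/2} z^κ` removed. -/
noncomputable def whittakerVComb {ι : Type*} [Fintype ι] (J : ι → ℕ) (c : ι → ℂ)
    (κ μ₀ ζ : ℂ) : ℂ :=
  ∑ i, c i * iteratedDeriv (J i) (fun μ => whittakerV (1 / 2 - κ + μ) (1 / 2 - κ - μ) ζ) μ₀

theorem whittakerComb_eq {ι : Type*} [Fintype ι] (J : ι → ℕ) (c : ι → ℂ) (κ μ₀ ζ : ℂ) :
    whittakerComb J c κ μ₀ ζ =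
      exp (-(exp ζ / 2)) * exp (κ * ζ) * whittakerVComb J c κ μ₀ ζ := by
  rw [whittakerComb, whittakerVComb, Finset.mul_sum]
  refine Finset.sum_congr rfl fun i _ => ?_
  simp only [whittakerDeriv, whittakerW_eq, iteratedDeriv_const_mul_field]
  ring

theorem exists_norm_whittakerVComb_sub_le {ι : Type*} [Fintype ι] (J : ι → ℕ) (c : ι → ℂ)
    (κ μ₀ : ℂ) {θ : ℝ} (hθ : |θ| < 3 * Real.pi / 2) (N : ℕ) :
    ∃ C : ℝ, 0 ≤ C ∧ ∀ r : ℝ, 1 ≤ r →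
      ‖whittakerVComb J c κ μ₀ (polarLog r θ) - ∑ k ∈ Finset.range N,
        derivFunctional J c μ₀ (whittakerPoly κ k) * exp (-polarLog r θ) ^ k‖ ≤
          C * r⁻¹ ^ N := by
  obtain ⟨C, hC, h⟩ := exists_norm_whittakerV_sub_le hθ N (1 / 2 - κ) (1 / 2 - κ) μ₀
  refine ⟨∑ i, ‖c i‖ * ((J i).factorial * C), by positivity, fun r hr => ?_⟩
  set Z := exp (-polarLog r θ) with hZ
  set V : ℂ → ℂ := fun μ => whittakerV (1 / 2 - κ + μ) (1 / 2 - κ - μ) (polarLog r θ) with hV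
  have hVd : Differentiable ℂ V := differentiable_whittakerV (by rwa [polarLog_im]) _ _
  set T : Polynomial ℂ := ∑ k ∈ Finset.range N, Z ^ k • whittakerPoly κ k with hT
  have hTe : ∀ μ, T.eval μ = ∑ k ∈ Finset.range N,
      whittakerCoeff k (1 / 2 - κ + μ) (1 / 2 - κ - μ) * Z ^ k := fun μ => by
    rw [hT, Polynomial.eval_finsetSum]
    refine Finset.sum_congr rfl fun k _ => ?_
    rw [Polynomial.eval_smul, eval_whittakerPoly, smul_eq_mul, mul_comm]
  have hΛ : ∑ k ∈ Finset.range N, derivFunctional J c μ₀ (whittakerPoly κ k) * Z ^ k =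
      ∑ i, c i * iteratedDeriv (J i) (fun μ => T.eval μ) μ₀ := by
    have : derivFunctional J c μ₀ T =
        ∑ k ∈ Finset.range N, derivFunctional J c μ₀ (whittakerPoly κ k) * Z ^ k := by
      rw [hT, map_sum]
      exact Finset.sum_congr rfl fun k _ => by rw [map_smul, smul_eq_mul, mul_comm]
    rw [← this, derivFunctional_apply]
    exact Finset.sum_congr rfl fun i _ => by rw [iteratedDeriv_polynomial_eval]
  have hbound : ∀ j : ℕ, ‖iteratedDeriv j V μ₀ - iteratedDeriv j (fun μ => T.eval μ) μ₀‖ ≤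
      j.factorial * (C * r⁻¹ ^ N) := by
    intro j
    have hTd : Differentiable ℂ (fun μ => T.eval μ) := T.differentiable
    rw [← iteratedDeriv_sub hVd.contDiff.contDiffAt hTd.contDiff.contDiffAt]
    -- Cauchy's estimate on the unit circle about `μ₀` transfers the uniform error bound to the
    -- derivatives.
    have := norm_iteratedDeriv_le_of_forall_mem_sphere_norm_le (c := μ₀) (R := 1)
      (C := C * r⁻¹ ^ N) (f := V - fun μ => T.eval μ) j one_pos (hVd.sub hTd).diffContOnCl
      (fun μ hμ => ?_)
    · simpa using this
    · rw [Pi.sub_apply, hTe]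
      exact h μ (Metric.sphere_subset_closedBall hμ) r hr
  rw [hΛ, whittakerVComb, ← Finset.sum_sub_distrib, Finset.sum_mul]
  refine (norm_sum_le _ _).trans (Finset.sum_le_sum fun i _ => ?_)
  rw [← mul_sub, norm_mul]
  calc _ ≤ ‖c i‖ * ((J i).factorial * (C * r⁻¹ ^ N)) := by gcongr; exact hbound _
    _ = _ := by ring

/-- A combination of derivatives either has only odd-order terms at `μ₀ = 0`, or it is asymptotic
to a nonzero multiple of some `e^{-z/2} z^{κ-k}`. -/
theorem whittakerVComb_dichotomy {ι : Type*} [Fintype ι] {J : ι → ℕ}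
    (hJ : Function.Injective J) (c : ι → ℂ) (κ μ₀ : ℂ) {θ : ℝ} (hθ : |θ| < 3 * Real.pi / 2) :
    (∀ i, μ₀ ≠ 0 ∨ Even (J i) → c i = 0) ∨
      ∃ (k : ℕ) (L : ℂ), L ≠ 0 ∧ Tendsto (fun r : ℝ =>
        whittakerVComb J c κ μ₀ (polarLog r θ) * exp (polarLog r θ) ^ k) atTop (𝓝 L) := by
  by_cases h : ∀ k, derivFunctional J c μ₀ (whittakerPoly κ k) = 0
  · exact Or.inl fun i hi => eq_zero_of_derivFunctional_whittakerPoly_eq_zero hJ h i hi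
  right
  push Not at h
  classical
  set k := Nat.find h with hk
  have hne := Nat.find_spec h
  have hlt : ∀ j < k, derivFunctional J c μ₀ (whittakerPoly κ j) = 0 := fun j hj =>
    not_not.1 (Nat.find_min h hj)
  refine ⟨k, _, hne, ?_⟩
  -- Expanding one term past the first nonzero coefficient leaves an error `O(1/r)` after
  -- multiplication by `z^k`.
  obtain ⟨C, hC, hb⟩ := exists_norm_whittakerVComb_sub_le J c κ μ₀ hθ (k + 1)
  rw [tendsto_iff_norm_sub_tendsto_zero]
  have ht : Tendsto (fun r : ℝ => C * r⁻¹) atTop (𝓝 0) := by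
    simpa using tendsto_inv_atTop_zero.const_mul C
  refine squeeze_zero' (Eventually.of_forall fun r => norm_nonneg _) ?_ ht
  filter_upwards [eventually_ge_atTop 1] with r hr
  have hr0 : 0 < r := by linarith
  have hb := hb r hr
  rw [Finset.sum_range_succ, Finset.sum_eq_zero fun j hj => by
    rw [hlt j (Finset.mem_range.1 hj), zero_mul], zero_add] at hb
  have hz : exp (-polarLog r θ) ^ k * exp (polarLog r θ) ^ k = 1 := by
    rw [← mul_pow, ← exp_add, neg_add_cancel, exp_zero, one_pow]
  have hzn : ‖exp (polarLog r θ) ^ k‖ = r ^ k := by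
    rw [norm_pow, exp_polarLog hr0, norm_mul, norm_exp_ofReal_mul_I, mul_one, norm_real,
      Real.norm_of_nonneg hr0.le]
  have he : whittakerVComb J c κ μ₀ (polarLog r θ) * exp (polarLog r θ) ^ k -
      derivFunctional J c μ₀ (whittakerPoly κ k) =
      (whittakerVComb J c κ μ₀ (polarLog r θ) - derivFunctional J c μ₀ (whittakerPoly κ k) *
        exp (-polarLog r θ) ^ k) * exp (polarLog r θ) ^ k := by
    linear_combination derivFunctional J c μ₀ (whittakerPoly κ k) * hz
  rw [he, norm_mul, hzn]
  calc _ ≤ C * r⁻¹ ^ (k + 1) * r ^ k := by gcongr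
    _ = C * r⁻¹ := by rw [pow_succ, inv_pow]; field_simp

/-! ### Linear independence on rays -/

/-- The ratio of the values at `r + 1` and `r` tends to `exp (e^{iθ})`. A nonzero limit would force
this to be `1`, hence `e^{iθ} ∈ 2πiℤ`, contradicting `|e^{iθ}| = 1`. -/
theorem not_tendsto_exp_mul_exp_add_log (θ : ℝ) (β γ : ℂ) {L : ℂ} (hL : L ≠ 0) :
    ¬ Tendsto (fun r : ℝ => exp (r * exp (θ * I) + β * Real.log r + γ)) atTop (𝓝 L) := by
  intro h
  have h1 := h.comp (tendsto_atTop_add_const_right atTop (1 : ℝ) tendsto_id)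
  have h2 := h1.div h hL
  rw [div_self hL] at h2
  have hlog : Tendsto (fun r : ℝ => ((Real.log (r + 1) - Real.log r : ℝ) : ℂ)) atTop (𝓝 0) := by
    simpa [Function.comp_def] using
      (continuous_ofReal.tendsto (0 : ℝ)).comp (Real.tendsto_log_comp_add_sub_log 1)
  have h3 : Tendsto (fun r : ℝ => exp (exp (θ * I) +
      β * ((Real.log (r + 1) - Real.log r : ℝ) : ℂ))) atTop (𝓝 (exp (exp (θ * I)))) := by
    have := ((hlog.const_mul β).const_add (exp (θ * I))).cexp
    simpa using this
  have h4 : exp (exp (θ * I)) = 1 := by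
    refine tendsto_nhds_unique h3 (h2.congr fun r => ?_)
    simp only [Pi.div_apply, Function.comp_apply, id]
    rw [← exp_sub]
    congr 1
    push_cast
    ring
  obtain ⟨n, hn⟩ := exp_eq_one_iff.1 h4
  have h5 := congrArg norm hn
  rw [norm_exp_ofReal_mul_I] at h5
  simp only [norm_mul, norm_intCast, norm_I, mul_one, norm_real, RCLike.norm_ofNat,
    Real.norm_of_nonneg Real.pi_pos.le] at h5
  rcases eq_or_ne n 0 with rfl | hn0
  · simp at h5
  · have : (1 : ℝ) ≤ |(n : ℝ)| := by exact_mod_cast Int.one_le_abs hn0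
    nlinarith [Real.pi_gt_three]

theorem whittakerVComb_eq_zero_of_coeff_eq_zero {ι : Type*} [Fintype ι] {J : ι → ℕ} {c : ι → ℂ}
    (hc : ∀ i, c i = 0) (κ μ₀ ζ : ℂ) : whittakerVComb J c κ μ₀ ζ = 0 := by
  simp [whittakerVComb, hc]

/-- Linear independence of derivatives of the two Whittaker functions on a ray. -/
theorem linearIndependent_whittakerDeriv {ι : Type*} [Fintype ι] {J : ι → ℕ}
    (hJ : Function.Injective J) {μ₀ : ℂ} (hμ : ∀ i, μ₀ ≠ 0 ∨ Even (J i)) (κ : ℂ) {σ θ : ℝ}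
    (hσ : σ = 1 ∨ σ = -1) (hθ : |θ| < 3 * Real.pi / 2)
    (hθ' : |θ + σ * Real.pi| < 3 * Real.pi / 2) :
    LinearIndependent ℂ (Sum.elim
      (fun (j : ι) (r : Set.Ioi (0 : ℝ)) => whittakerDeriv (J j) κ μ₀ (polarLog r θ))
      (fun (j : ι) (r : Set.Ioi (0 : ℝ)) =>
        whittakerDeriv (J j) (-κ) μ₀ (polarLog r (θ + σ * Real.pi)))) := by
  rw [Fintype.linearIndependent_iff]
  intro g hg
  set c : ι → ℂ := fun i => g (Sum.inl i) with hc
  set d : ι → ℂ := fun i => g (Sum.inr i) with hd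
  set F : ℝ → ℂ := fun r => whittakerVComb J c κ μ₀ (polarLog r θ) with hF
  set G : ℝ → ℂ := fun r => whittakerVComb J d (-κ) μ₀ (polarLog r (θ + σ * Real.pi)) with hG
  have hexpσ : exp (σ * Real.pi * I) = -1 := by
    rcases hσ with rfl | rfl
    · simp
    · simp [exp_neg]
  have hz : ∀ r : ℝ, exp (polarLog r (θ + σ * Real.pi)) = -exp (polarLog r θ) := fun r => by
    have : polarLog r (θ + σ * Real.pi) = polarLog r θ + σ * Real.pi * I := by
      simp only [polarLog]; push_cast; ring
    rw [this, exp_add, hexpσ]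
    ring
  have hsum : ∀ r : ℝ, 0 < r → exp (-(exp (polarLog r θ) / 2)) * exp (κ * polarLog r θ) * F r +
      exp (exp (polarLog r θ) / 2) * exp (-κ * polarLog r (θ + σ * Real.pi)) * G r = 0 := by
    intro r hr
    have h1 := congrFun hg ⟨r, hr⟩
    simp only [Fintype.sum_sum_type, Sum.elim_inl, Sum.elim_inr, Finset.sum_apply,
      Pi.smul_apply, smul_eq_mul, Pi.zero_apply] at h1
    have h2 := whittakerComb_eq J c κ μ₀ (polarLog r θ)
    have h3 := whittakerComb_eq J d (-κ) μ₀ (polarLog r (θ + σ * Real.pi))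
    rw [hz r, neg_div, neg_neg] at h3
    rw [whittakerComb] at h2 h3
    rw [hF, hG]
    dsimp only
    rw [← h2, ← h3]
    exact h1
  rcases whittakerVComb_dichotomy hJ c κ μ₀ hθ with h1 | ⟨k, L, hL, h1⟩ <;>
    rcases whittakerVComb_dichotomy hJ d (-κ) μ₀ hθ' with h2 | ⟨l, L', hL', h2⟩
  · rintro (i | i)
    · exact h1 i (hμ i)
    · exact h2 i (hμ i)
  -- With one side zero, the relation makes the other vanish, as exponentials have no zeros; its
  -- limit could not be nonzero.
  · refine absurd (tendsto_nhds_unique h2 (tendsto_const_nhds.congr' ?_)) hL'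
    filter_upwards [eventually_gt_atTop 0] with r hr
    have h := hsum r hr
    have hF0 : F r = 0 := whittakerVComb_eq_zero_of_coeff_eq_zero (fun i => h1 i (hμ i)) _ _ _
    have hG0 : G r = 0 := by simpa [hF0] using h
    change 0 = G r * _
    rw [hG0, zero_mul]
  · refine absurd (tendsto_nhds_unique h1 (tendsto_const_nhds.congr' ?_)) hL
    filter_upwards [eventually_gt_atTop 0] with r hr
    have h := hsum r hr
    have hG0 : G r = 0 := whittakerVComb_eq_zero_of_coeff_eq_zero (fun i => h2 i (hμ i)) _ _ _
    have hF0 : F r = 0 := by simpa [hG0] using h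
    change 0 = F r * _
    rw [hF0, zero_mul]
  · exfalso
    -- The relation equates minus the quotient of the normalized combinations with `e^z z^{k-κ}
    -- z'^{-κ-l}`, where `log z' = log z + σπi`; this fixes both constants.
    refine not_tendsto_exp_mul_exp_add_log θ (k - l - 2 * κ)
      ((k - l - 2 * κ) * (θ * I) + (-κ - l) * (σ * Real.pi * I))
      (neg_ne_zero.2 (div_ne_zero hL hL')) ((h1.div h2 hL').neg.congr' ?_)
    filter_upwards [eventually_gt_atTop 0, h2.eventually_ne hL'] with r hr hne
    have h := hsum r hr
    rw [Pi.div_apply, ← neg_div, div_eq_iff hne]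
    change -(F r * _) = _ * (G r * _)
    set ζ := polarLog r θ with hζ
    set ζ' := polarLog r (θ + σ * Real.pi) with hζ'
    have e1 : (r : ℂ) * exp (θ * I) + (k - l - 2 * κ) * Real.log r +
        ((k - l - 2 * κ) * (θ * I) + (-κ - l) * (σ * Real.pi * I)) =
        exp ζ / 2 + exp ζ / 2 + -κ * ζ' + -(κ * ζ) + k * ζ + -(l * ζ') := by
      rw [hζ, exp_polarLog hr, hζ']
      simp only [polarLog]
      push_cast
      ring
    have e2 : exp (-(exp ζ / 2)) * exp (exp ζ / 2) = 1 := by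
      rw [← exp_add, neg_add_cancel, exp_zero]
    have e3 : exp (κ * ζ) * exp (-(κ * ζ)) = 1 := by rw [← exp_add, add_neg_cancel, exp_zero]
    have e4 : exp (-(l * ζ')) * exp (l * ζ') = 1 := by rw [← exp_add, neg_add_cancel, exp_zero]
    rw [e1, exp_add, exp_add, exp_add, exp_add, exp_add, ← exp_nat_mul, ← exp_nat_mul]
    linear_combination (-exp (exp ζ / 2) * exp (-(κ * ζ)) * exp (k * ζ)) * h +
      (F r * exp (k * ζ) * exp (κ * ζ) * exp (-(κ * ζ))) * e2 + F r * exp (k * ζ) * e3 -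
      (exp (exp ζ / 2) ^ 2 * exp (-κ * ζ') * exp (-(κ * ζ)) * exp (k * ζ) * G r) * e4

/-! ### Exponential decay and growth -/

theorem isBigO_rpow_mul_exp (p : ℝ) {a b : ℝ} (hab : a < b) :
    (fun y : ℝ => y ^ p * Real.exp (a * y)) =O[atTop] fun y : ℝ => Real.exp (b * y) := by
  have h := ((isLittleO_rpow_exp_pos_mul_atTop p (sub_pos.2 hab)).isBigO.mul
    (isBigO_refl (fun y : ℝ => Real.exp (a * y)) atTop))
  refine h.trans_eventuallyEq (Eventually.of_forall fun y => ?_)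
  dsimp only
  rw [← Real.exp_add]
  ring_nf

theorem norm_exp_mul_polarLog {y : ℝ} (hy : 0 < y) (β : ℂ) (θ : ℝ) :
    ‖exp (β * polarLog y θ)‖ = y ^ β.re * Real.exp (-(β.im * θ)) := by
  rw [norm_exp, Real.rpow_def_of_pos hy, ← Real.exp_add]
  congr 1
  simp only [polarLog, mul_re, add_re, add_im, ofReal_re, ofReal_im, I_re, I_im, mul_im]
  ring

theorem decaysExponentially_whittakerComb {ι : Type*} [Fintype ι] (J : ι → ℕ) (c : ι → ℂ)
    (κ μ₀ : ℂ) : DecaysExponentially fun y => whittakerComb J c κ μ₀ (polarLog y 0) := by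
  have h0 : |(0 : ℝ)| < 3 * Real.pi / 2 := by rw [abs_zero]; positivity
  -- Order `0`: the sum is empty, so this is plain boundedness.
  obtain ⟨C, hC, h⟩ := exists_norm_whittakerVComb_sub_le J c κ μ₀ h0 0
  refine ⟨1 / 4, by norm_num, ?_⟩
  have hO : (fun y => whittakerComb J c κ μ₀ (polarLog y 0)) =O[atTop]
      fun y : ℝ => y ^ κ.re * Real.exp (-(1 / 2) * y) := by
    refine IsBigO.of_bound C ?_
    filter_upwards [eventually_ge_atTop 1] with y hy
    have hy0 : 0 < y := by linarith
    have hV : ‖whittakerVComb J c κ μ₀ (polarLog y 0)‖ ≤ C := by simpa using h y hy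
    rw [whittakerComb_eq, norm_mul, norm_mul, norm_exp_mul_polarLog hy0, exp_polarLog hy0,
      norm_exp, Real.norm_of_nonneg (by positivity)]
    have e1 : (-((y : ℂ) * exp ((0 : ℝ) * I) / 2)).re = -(1 / 2) * y := by
      have : -((y : ℂ) * exp ((0 : ℝ) * I) / 2) = ((-(1 / 2) * y : ℝ) : ℂ) := by
        push_cast; simp; ring
      rw [this, ofReal_re]
    rw [e1, mul_zero, neg_zero, Real.exp_zero, mul_one]
    calc _ ≤ Real.exp (-(1 / 2) * y) * y ^ κ.re * C := by gcongr
      _ = _ := by ring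
  refine (hO.trans (isBigO_rpow_mul_exp κ.re (b := -(1 / 4)) (by norm_num))).trans_eventuallyEq
    (Eventually.of_forall fun y => ?_)
  ring_nf

theorem growsExponentially_whittakerComb {ι : Type*} [Fintype ι] {J : ι → ℕ}
    (hJ : Function.Injective J) (c : ι → ℂ) (κ μ₀ : ℂ) {θ : ℝ} (hθ : |θ| < 3 * Real.pi / 2)
    (hexp : exp (θ * I) = -1)
    (hne : ∃ y : ℝ, 0 < y ∧ whittakerComb J c κ μ₀ (polarLog y θ) ≠ 0) :
    GrowsExponentially fun y => whittakerComb J c κ μ₀ (polarLog y θ) := by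
  rcases whittakerVComb_dichotomy hJ c κ μ₀ hθ with h | ⟨k, L, hL, h⟩
  · obtain ⟨y, hy, hne⟩ := hne
    -- In the degenerate alternative only odd orders at `μ₀ = 0` remain, and these derivatives
    -- vanish.
    refine absurd (Finset.sum_eq_zero fun i _ => ?_) hne
    by_cases hi : μ₀ ≠ 0 ∨ Even (J i)
    · rw [h i hi, zero_mul]
    · push Not at hi
      obtain ⟨n, hn⟩ := Nat.not_even_iff_odd.1 hi.2
      rw [hi.1, hn, whittakerDeriv_odd (by rwa [polarLog_im]), mul_zero]
  · set p : ℝ := (κ - k).re with hp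
    set Q : ℝ := Real.exp (-((κ - k).im * θ)) with hQ
    have hQ0 : 0 < Q := Real.exp_pos _
    set B : ℝ → ℂ := fun y =>
      whittakerVComb J c κ μ₀ (polarLog y θ) * exp (polarLog y θ) ^ k with hB
    have hnorm : ∀ y : ℝ, 0 < y → ‖whittakerComb J c κ μ₀ (polarLog y θ)‖ =
        y ^ p * Real.exp (1 / 2 * y) * (Q * ‖B y‖) := by
      intro y hy
      have e1 : whittakerComb J c κ μ₀ (polarLog y θ) = exp ((1 / 2 * y : ℝ) : ℂ) *
          exp ((κ - k) * polarLog y θ) * B y := by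
        have e2 : exp (κ * polarLog y θ) =
            exp ((κ - k) * polarLog y θ) * exp (polarLog y θ) ^ k := by
          rw [← exp_nat_mul, ← exp_add]; ring_nf
        have e3 : -(exp (polarLog y θ) / 2) = ((1 / 2 * y : ℝ) : ℂ) := by
          rw [exp_polarLog hy, hexp]; push_cast; ring
        rw [whittakerComb_eq, e2, e3, hB]
        ring
      rw [e1, norm_mul, norm_mul, norm_exp_mul_polarLog hy, norm_exp, ofReal_re]
      ring
    have hlim : Tendsto (fun y => Q * ‖B y‖) atTop (𝓝 (Q * ‖L‖)) := h.norm.const_mul Q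
    have hQL : 0 < Q * ‖L‖ := by positivity
    have hupper : (fun y => whittakerComb J c κ μ₀ (polarLog y θ)) =O[atTop]
        fun y : ℝ => y ^ p * Real.exp (1 / 2 * y) := by
      refine IsBigO.of_bound (2 * (Q * ‖L‖)) ?_
      filter_upwards [eventually_gt_atTop 0, hlim.eventually_le_const
        (by linarith : Q * ‖L‖ < 2 * (Q * ‖L‖))] with y hy hle
      rw [hnorm y hy, Real.norm_of_nonneg (by positivity), mul_comm]
      gcongr
    have hlower : (fun y : ℝ => y ^ p * Real.exp (1 / 2 * y)) =O[atTop]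
        fun y => whittakerComb J c κ μ₀ (polarLog y θ) := by
      refine IsBigO.of_bound (Q * ‖L‖ / 2)⁻¹ ?_
      filter_upwards [eventually_gt_atTop 0, hlim.eventually_const_le
        (by linarith : Q * ‖L‖ / 2 < Q * ‖L‖)] with y hy hle
      rw [hnorm y hy, Real.norm_of_nonneg (by positivity), mul_left_comm]
      refine le_mul_of_one_le_right (by positivity) ?_
      rw [inv_mul_eq_div, one_le_div (by positivity)]
      exact hle
    -- The size is `y^p e^{y/2}`; any rates on either side of `1/2` absorb the power.
    refine ⟨1 / 4, 1, by norm_num, ?_, hupper.trans (isBigO_rpow_mul_exp p (by norm_num))⟩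
    refine IsBigO.trans ?_ hlower
    have h1 := (isBigO_refl (fun y : ℝ => y ^ p) atTop).mul
      (isBigO_rpow_mul_exp (-p) (a := 1 / 4) (b := 1 / 2) (by norm_num))
    refine (EventuallyEq.trans_isBigO ?_ h1)
    filter_upwards [eventually_gt_atTop 0] with y hy
    rw [← mul_assoc, ← Real.rpow_add hy, add_neg_cancel, Real.rpow_zero, one_mul]

/-! ### The main theorem -/

theorem mainTheorem9 (κ μ₀ : ℂ) :
    -- linear independence, on each ray `arg z = θ`, with `-z = z e^{iπσ}`, `σ = ±1`
    (∀ σ θ : ℝ, (σ = 1 ∨ σ = -1) → |θ| < 3 * Real.pi / 2 →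
      |θ + σ * Real.pi| < 3 * Real.pi / 2 → ∀ m : ℕ,
      (μ₀ ≠ 0 →
        LinearIndependent ℂ (Sum.elim
          (fun (j : Fin (m + 1)) (r : Set.Ioi (0 : ℝ)) =>
            whittakerDeriv j κ μ₀ (polarLog r θ))
          (fun (j : Fin (m + 1)) (r : Set.Ioi (0 : ℝ)) =>
            whittakerDeriv j (-κ) μ₀ (polarLog r (θ + σ * Real.pi))))) ∧
      (μ₀ = 0 →
        LinearIndependent ℂ (Sum.elim
          (fun (j : Fin (m + 1)) (r : Set.Ioi (0 : ℝ)) =>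
            whittakerDeriv (2 * j) κ 0 (polarLog r θ))
          (fun (j : Fin (m + 1)) (r : Set.Ioi (0 : ℝ)) =>
            whittakerDeriv (2 * j) (-κ) 0 (polarLog r (θ + σ * Real.pi)))))) ∧
    -- the odd-order derivatives at `μ = 0` vanish identically, in both families
    (μ₀ = 0 → ∀ (j : ℕ) (ζ : ℂ), |ζ.im| < 3 * Real.pi / 2 →
      whittakerDeriv (2 * j + 1) κ 0 ζ = 0 ∧ whittakerDeriv (2 * j + 1) (-κ) 0 ζ = 0) ∧
    -- combinations of the first family decay exponentially on the positive axis
    (∀ (m : ℕ) (c : Fin (m + 1) → ℂ),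
      DecaysExponentially fun y : ℝ =>
        ∑ j : Fin (m + 1), c j * whittakerDeriv j κ μ₀ (polarLog y 0)) ∧
    -- nonzero combinations of the second family grow exponentially on the positive axis
    (∀ σ : ℝ, (σ = 1 ∨ σ = -1) → ∀ (m : ℕ) (c : Fin (m + 1) → ℂ),
      (∃ y : ℝ, 0 < y ∧
        ∑ j : Fin (m + 1), c j * whittakerDeriv j (-κ) μ₀ (polarLog y (σ * Real.pi)) ≠ 0) →
      GrowsExponentially fun y : ℝ =>
        ∑ j : Fin (m + 1), c j * whittakerDeriv j (-κ) μ₀ (polarLog y (σ * Real.pi))) := by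

  have hcast : ∀ m : ℕ, Function.Injective (fun j : Fin (m + 1) => (j : ℕ)) := fun m =>
    Fin.val_injective
  refine ⟨fun σ θ hσ hθ hθ' m => ⟨fun hμ => ?_, fun _ => ?_⟩, fun _ j ζ hζ =>
    ⟨whittakerDeriv_odd hζ j κ, whittakerDeriv_odd hζ j (-κ)⟩,
    fun m c => decaysExponentially_whittakerComb (fun j : Fin (m + 1) => (j : ℕ)) c κ μ₀,
    fun σ hσ m c hne => ?_⟩
  · exact linearIndependent_whittakerDeriv (hcast m) (fun _ => Or.inl hμ) κ hσ hθ hθ'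
  · exact linearIndependent_whittakerDeriv (J := fun j : Fin (m + 1) => 2 * (j : ℕ))
      (fun i j h => hcast m (by simpa using h)) (fun j => Or.inr (even_two_mul _)) κ hσ hθ hθ'
  · have hpi := Real.pi_pos
    refine growsExponentially_whittakerComb (hcast m) c (-κ) μ₀ ?_ ?_ hne
    · rcases hσ with rfl | rfl
      · rw [one_mul, abs_of_pos hpi]; linarith
      · rw [neg_one_mul, abs_neg, abs_of_pos hpi]; linarith
    · rcases hσ with rfl | rfl
      · simp
      · simp [exp_neg]
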